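/- All algebras are over $\mathbb{C}$ and not necessarily associative. Put $J(a,b,c)=(ab)c+(bc)a+(ca)b$. An anticommutative algebra is a Tortkara algebra if $(ab)(cb)=J(a,b,c)b$ for all $a,b,c$, and a Malcev algebra if $J(a,b,ac)=J(a,b,c)a$ for all $a,b,c$. An algebra $A$ is nilpotent if $A^n=0$ for some $n\ge 1$, where $A^1=A$ and $A^n=\sum_{k=1}^{n-1}A^kA^{n-k}$; it is nontrivial if its product is not identically zero. For a Tortkara algebra $A$ let $Z^2_T(A)$ be the space of skew-symmetric bilinear forms $\theta:A\times A\to\mathbb{C}$ with $\theta(xy,zt)+\theta(xt,zy)=\theta(J(x,y,z),t)+\theta(J(x,t,z),y)$ for all $x,y,z,t\in A$, let $B^2(A)=\{(x,y)\mapsto f(xy) : f\in A^*\}\subseteq Z^2_T(A)$, and let $H^2_T(A)=Z^2_T(A)/B^2(A)$. If $A$ is moreover a Malcev algebra, let $Z^2_{TM}(A)$ be the space of all $\theta\in Z^2_T(A)$ with $\theta(wy,xz)=\theta((wx)y,z)+\theta((xy)z,w)+\theta((yz)w,x)+\theta((zw)x,y)$ for all $x,y,z,w\in A$, and let $H^2_{TM}(A)=Z^2_{TM}(A)/B^2(A)\subseteq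 H^2_T(A)$. Let $\mathbb{T}^5_{01},\dots,\mathbb{T}^5_{10}$ be the anticommutative algebras with basis $e_1,\dots,e_5$ and the following products of basis vectors (those that do not follow from the listed ones by anticommutativity are zero). Let $\Delta_{ij}$ be the skew-symmetric bilinear form with $\Delta_{ij}(e_i,e_j)=1=-\Delta_{ij}(e_j,e_i)$ that vanishes on all other pairs of basis vectors. - $\mathbb{T}^5_{01}$: $e_1e_2=e_3$; - $\mathbb{T}^5_{02}$: $e_1e_2=e_3,\ e_1e_3=e_4$; - $\mathbb{T}^5_{03}$: $e_1e_2=e_4,\ e_1e_3=e_5$; - $\mathbb{T}^5_{04}$: $e_1e_2=e_3,\ e_1e_3=e_4,\ e_2e_3=e_5$; - $\mathbb{T}^5_{05}$: $e_1e_2=e_5,\ e_3e_4=e_5$; - $\mathbb{T}^5_{06}$: $e_1e_2=e_3,\ e_1e_4=e_5,\ e_2e_3=e_5$; - $\mathbb{T}^5_{07}$: $e_1e_2=e_3,\ e_3e_4=e_5$; - $\mathbb{T}^5_{08}$: $e_1e_2=e_3,\ e_1e_3=e_4,\ e_1e_4=e_5$; - $\mathbb{T}^5_{09}$: $e_1e_2=e_3,\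 e_1e_3=e_4,\ e_1e_4=e_5,\ e_2e_3=e_5$; - $\mathbb{T}^5_{10}$: $e_1e_2=e_3,\ e_1e_3=e_4,\ e_2e_4=e_5$. Then: (1) Each of these ten algebras is a nontrivial 5-dimensional nilpotent Tortkara algebra, and every nontrivial 5-dimensional nilpotent Tortkara algebra over $\mathbb{C}$ is isomorphic to exactly one of them. (2) $\mathbb{T}^5_{01},\dots,\mathbb{T}^5_{09}$ are Malcev algebras, and $\mathbb{T}^5_{10}$ is not. (3) For the first nine algebras, $H^2_{TM}$ has as a basis the classes of the following forms. - $\mathbb{T}^5_{01}$: $\Delta_{13},\Delta_{14},\Delta_{15},\Delta_{23},\Delta_{24},\Delta_{25},\Delta_{34},\Delta_{35},\Delta_{45}$; - $\mathbb{T}^5_{02}$: $\Delta_{14},\Delta_{15},\Delta_{23},\Delta_{25},\Delta_{35}$; - $\mathbb{T}^5_{03}$: $\Delta_{14},\Delta_{15},\Delta_{23},\Delta_{24},\Delta_{25},\Delta_{34},\Delta_{35}$; - $\mathbb{T}^5_{04}$: $\Delta_{14},\Delta_{15}+\Delta_{24},\Delta_{25}$; - $\mathbb{T}^5_{05}$: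 $\Delta_{12},\Delta_{13},\Delta_{14},\Delta_{15},\Delta_{23},\Delta_{24},\Delta_{25},\Delta_{35},\Delta_{45}$; - $\mathbb{T}^5_{06}$: $\Delta_{13},\Delta_{14},\Delta_{24},\Delta_{25},\Delta_{34}$; - $\mathbb{T}^5_{07}$: $\Delta_{13},\Delta_{14},\Delta_{23},\Delta_{24}$; - $\mathbb{T}^5_{08}$: $\Delta_{15},\Delta_{23}$; - $\mathbb{T}^5_{09}$: $\Delta_{14},\Delta_{15}+\Delta_{24}$. (4) For $\mathbb{T}^5_{01},\mathbb{T}^5_{03},\mathbb{T}^5_{05},\mathbb{T}^5_{07}$ one has $H^2_T=H^2_{TM}$. A basis of $H^2_T$ is obtained from the basis of $H^2_{TM}$ in (3) by adding the classes of $\Delta_{24},\Delta_{45}$ for $\mathbb{T}^5_{02}$; of $\Delta_{15}$ for $\mathbb{T}^5_{04}$; of $\Delta_{15},\Delta_{45}$ for $\mathbb{T}^5_{06}$; of $\Delta_{24},\Delta_{25}$ for $\mathbb{T}^5_{08}$; of $\Delta_{15},\Delta_{25}$ for $\mathbb{T}^5_{09}$. The classes of $\Delta_{14},\Delta_{23},\Delta_{34}+\Delta_{15}$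 are a basis of $H^2_T(\mathbb{T}^5_{10})$. -/

import Mathlib

namespace Tortkara

section General

variable (A : Type*) [NonUnitalNonAssocRing A] [Module ℂ A]

/-- The powers `A^n` of a (not necessarily associative) algebra: `A^1 = A` and, for `m ≥ 2`,
`A^m = ∑_{k = 1}^{m - 1} A^k A^(m-k)`, where `XY` is the span of the products `x * y` with
`x ∈ X`, `y ∈ Y`. (The value at `0` is a convention.) -/
def power : ℕ → Submodule ℂ A
  | 0 => ⊤
  | 1 => ⊤
  | n + 2 => ⨆ k : Fin (n + 1),
      Submodule.span ℂ {z | ∃ x ∈ power (k + 1), ∃ y ∈ power (n + 1 - k), z = x * y}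
termination_by n => n
decreasing_by all_goals omega

/-- Some power of the algebra vanishes. -/
def IsNilpotentAlgebra : Prop := ∃ n, 1 ≤ n ∧ power A n = ⊥

/-- The product of the algebra is not identically zero. -/
def IsNontrivialAlgebra : Prop := ∃ x y : A, x * y ≠ 0

variable {A} in
/-- The Jacobian `J(a,b,c) = (ab)c + (bc)a + (ca)b`. -/
def jacobian (a b c : A) : A := (a * b) * c + (b * c) * a + (c * a) * b

/-- Tortkara algebras: anticommutative, with `(ab)(cb) = J(a,b,c)b`. -/
structure IsTortkara : Prop where
  anticomm : ∀ a b : A, a * b = -(b * a)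
  tortkara : ∀ a b c : A, (a * b) * (c * b) = jacobian a b c * b

/-- Malcev algebras: anticommutative, with `J(a,b,ac) = J(a,b,c)a`. -/
structure IsMalcev : Prop where
  anticomm : ∀ a b : A, a * b = -(b * a)
  malcev : ∀ a b c : A, jacobian a b (a * c) = jacobian a b c * a

/-- Isomorphism of algebras over `ℂ`. -/
def IsIsomorphic (B : Type*) [NonUnitalNonAssocRing B] [Module ℂ B] : Prop :=
  ∃ e : A ≃ₗ[ℂ] B, ∀ x y : A, e (x * y) = e x * e y

/-- The space `Z²_T(A, ℂ)` of Tortkara cocycles. -/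
def cocyclesT : Submodule ℂ (LinearMap.BilinForm ℂ A) where
  carrier := {θ | (∀ x y, θ x y = -θ y x) ∧
    ∀ x y z t, θ (x * y) (z * t) + θ (x * t) (z * y) =
      θ (jacobian x y z) t + θ (jacobian x t z) y}
  zero_mem' := by simp
  add_mem' := by
    rintro θ η ⟨h1, h2⟩ ⟨k1, k2⟩
    refine ⟨fun x y => ?_, fun x y z t => ?_⟩
    · simp only [LinearMap.add_apply]
      rw [h1 x y, k1 x y]; ring
    · simp only [LinearMap.add_apply]
      linear_combination h2 x y z t + k2 x y z t
  smul_mem' := by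
    rintro c θ ⟨h1, h2⟩
    refine ⟨fun x y => ?_, fun x y z t => ?_⟩
    · simp only [LinearMap.smul_apply, smul_eq_mul]
      rw [h1 x y]; ring
    · simp only [LinearMap.smul_apply, smul_eq_mul]
      linear_combination c * h2 x y z t

/-- The space `Z²_TM(A, ℂ)` of those Tortkara cocycles of a Malcev algebra `A` whose central
extensions are Malcev algebras. -/
def cocyclesTM : Submodule ℂ (LinearMap.BilinForm ℂ A) where
  carrier := {θ | θ ∈ cocyclesT A ∧
    ∀ x y z w, θ (w * y) (x * z) = θ ((w * x) * y) z + θ ((x * y) * z) w +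
      θ ((y * z) * w) x + θ ((z * w) * x) y}
  zero_mem' := by simp
  add_mem' := by
    rintro θ η ⟨h1, h2⟩ ⟨k1, k2⟩
    refine ⟨add_mem h1 k1, fun x y z w => ?_⟩
    simp only [LinearMap.add_apply]
    linear_combination h2 x y z w + k2 x y z w
  smul_mem' := by
    rintro c θ ⟨h1, h2⟩
    refine ⟨Submodule.smul_mem _ c h1, fun x y z w => ?_⟩
    simp only [LinearMap.smul_apply, smul_eq_mul]
    linear_combination c * h2 x y z w

/-- The space `B²(A, ℂ)` of coboundaries `δf (x, y) = f (xy)`, with `f : A → ℂ` linear. -/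
def coboundaries : Submodule ℂ (LinearMap.BilinForm ℂ A) where
  carrier := {θ | ∃ f : A →ₗ[ℂ] ℂ, ∀ x y, θ x y = f (x * y)}
  zero_mem' := ⟨0, by simp⟩
  add_mem' := by
    rintro θ η ⟨f, hf⟩ ⟨g, hg⟩
    exact ⟨f + g, fun x y => by simp [hf, hg]⟩
  smul_mem' := by
    rintro c θ ⟨f, hf⟩
    exact ⟨c • f, fun x y => by simp [hf]⟩

/-- The class `[θ]` of a bilinear form modulo coboundaries. -/
abbrev cohomologyClass :
    LinearMap.BilinForm ℂ A →ₗ[ℂ] LinearMap.BilinForm ℂ A ⧸ coboundaries A :=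
  (coboundaries A).mkQ

/-- `H²_T(A, ℂ) = Z²_T(A, ℂ) / B²(A, ℂ)`, realised as the space of the classes of cocycles inside
the bilinear forms modulo `B²(A, ℂ)`. For a Tortkara algebra `B² ⊆ Z²_T`. -/
def cohomologyT : Submodule ℂ (LinearMap.BilinForm ℂ A ⧸ coboundaries A) :=
  (cocyclesT A).map (cohomologyClass A)

/-- `H²_TM(A, ℂ) = Z²_TM(A, ℂ) / B²(A, ℂ)`, as a subspace of `H²_T(A, ℂ)`. -/
def cohomologyTM : Submodule ℂ (LinearMap.BilinForm ℂ A ⧸ coboundaries A) :=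
  (cocyclesTM A).map (cohomologyClass A)

/-- The classes `[θ]`, `θ ∈ L`, are a basis of the subspace `H` (without repetitions). -/
def ClassesFormBasis (L : List (LinearMap.BilinForm ℂ A))
    (H : Submodule ℂ (LinearMap.BilinForm ℂ A ⧸ coboundaries A)) : Prop :=
  LinearIndependent ℂ (fun k : Fin L.length => cohomologyClass A (L.get k)) ∧
    Submodule.span ℂ (Set.range fun k : Fin L.length => cohomologyClass A (L.get k)) = H

end General

/-! ### The ten algebras -/

/-- The indices of the basis vectors `e₁, …, e₅` of `ℂ⁵`. -/
abbrev e1 : Fin 5 := 0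
/-- The index of `e₂`. -/
abbrev e2 : Fin 5 := 1
/-- The index of `e₃`. -/
abbrev e3 : Fin 5 := 2
/-- The index of `e₄`. -/
abbrev e4 : Fin 5 := 3
/-- The index of `e₅`. -/
abbrev e5 : Fin 5 := 4

/-- The multiplication tables: an entry `(p, q, r)` stands for `e_p e_q = e_r` (and hence
`e_q e_p = -e_r`); all products of basis vectors not listed are zero. -/
def table : Fin 10 → List (Fin 5 × Fin 5 × Fin 5) :=
  ![[(e1, e2, e3)],
    [(e1, e2, e3), (e1, e3, e4)],
    [(e1, e2, e4), (e1, e3, e5)],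
    [(e1, e2, e3), (e1, e3, e4), (e2, e3, e5)],
    [(e1, e2, e5), (e3, e4, e5)],
    [(e1, e2, e3), (e1, e4, e5), (e2, e3, e5)],
    [(e1, e2, e3), (e3, e4, e5)],
    [(e1, e2, e3), (e1, e3, e4), (e1, e4, e5)],
    [(e1, e2, e3), (e1, e3, e4), (e1, e4, e5), (e2, e3, e5)],
    [(e1, e2, e3), (e1, e3, e4), (e2, e4, e5)]]

/-- The algebra `𝕋⁵_{n+1}`: the space `ℂ⁵` with the anticommutative product of `table n`. -/
def T5 (_n : Fin 10) : Type := Fin 5 → ℂ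

instance (n : Fin 10) : AddCommGroup (T5 n) := inferInstanceAs (AddCommGroup (Fin 5 → ℂ))

instance (n : Fin 10) : Module ℂ (T5 n) := inferInstanceAs (Module ℂ (Fin 5 → ℂ))

/-- The skew-symmetric bilinear form `Δ_{pq}` with `Δ_{pq}(e_p, e_q) = 1`. -/
def Delta (n : Fin 10) (p q : Fin 5) : LinearMap.BilinForm ℂ (T5 n) :=
  LinearMap.mk₂ ℂ (fun x y => x p * y q - x q * y p)
    (fun x x' y => by
      change (x p + x' p) * y q - (x q + x' q) * y p = _
      ring)
    (fun c x y => by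
      change (c * x p) * y q - (c * x q) * y p = c * _
      ring)
    (fun x y y' => by
      change x p * (y q + y' q) - x q * (y p + y' p) = _
      ring)
    (fun c x y => by
      change x p * (c * y q) - x q * (c * y p) = c * _
      ring)

/-- The product `xy = ∑ Δ_{pq}(x, y) e_r`, the sum over the entries `(p, q, r)` of the table. -/
def product (n : Fin 10) (x y : T5 n) : T5 n := fun k =>
  ((table n).map fun t => if t.2.2 = k then Delta n t.1 t.2.1 x y else 0).sum

lemma sum_map_ite_add {ι : Type*} (L : List ι) (P : ι → Prop) [DecidablePred P] (f g : ι → ℂ) :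
    (L.map fun t => if P t then f t + g t else 0).sum =
      (L.map fun t => if P t then f t else 0).sum + (L.map fun t => if P t then g t else 0).sum := by
  induction L with
  | nil => simp
  | cons a L ih =>
    simp only [List.map_cons, List.sum_cons, ih]
    split_ifs <;> ring

lemma sum_map_ite_mul {ι : Type*} (L : List ι) (P : ι → Prop) [DecidablePred P] (c : ℂ)
    (f : ι → ℂ) :
    (L.map fun t => if P t then c * f t else 0).sum =
      c * (L.map fun t => if P t then f t else 0).sum := by
  induction L with
  | nil => simp
  | cons a L ih =>
    simp only [List.map_cons, List.sum_cons, ih]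
    split_ifs <;> ring

lemma product_add_left (n : Fin 10) (x x' y : T5 n) :
    product n (x + x') y = product n x y + product n x' y := by
  funext k
  simp only [product, map_add, LinearMap.add_apply]
  exact sum_map_ite_add _ _ _ _

lemma product_add_right (n : Fin 10) (x y y' : T5 n) :
    product n x (y + y') = product n x y + product n x y' := by
  funext k
  simp only [product, map_add]
  exact sum_map_ite_add _ _ _ _

lemma product_smul_left (n : Fin 10) (c : ℂ) (x y : T5 n) :
    product n (c • x) y = c • product n x y := by
  funext k
  simp only [product, map_smul, LinearMap.smul_apply, smul_eq_mul]
  exact sum_map_ite_mul _ _ _ _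

lemma product_smul_right (n : Fin 10) (c : ℂ) (x y : T5 n) :
    product n x (c • y) = c • product n x y := by
  funext k
  simp only [product, map_smul, smul_eq_mul]
  exact sum_map_ite_mul _ _ _ _

instance (n : Fin 10) : NonUnitalNonAssocRing (T5 n) where
  mul := product n
  left_distrib := product_add_right n
  right_distrib := product_add_left n
  zero_mul y := by
    change product n 0 y = 0
    simpa using product_smul_left n 0 0 y
  mul_zero x := by
    change product n x 0 = 0
    simpa using product_smul_right n 0 x 0

instance (n : Fin 10) : IsScalarTower ℂ (T5 n) (T5 n) := ⟨fun c x y => product_smul_left n c x y⟩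

instance (n : Fin 10) : SMulCommClass ℂ (T5 n) (T5 n) :=
  ⟨fun c x y => (product_smul_right n c x y).symm⟩

/-- Forms `∑ Δ_{pq}`, each given by the list of its pairs `(p, q)`; their classes are to form a
basis of `H²_TM(𝕋⁵_{n+1}, ℂ)`. The last entry is void: `𝕋⁵₁₀` is not a Malcev algebra. -/
def pairsTM : Fin 10 → List (List (Fin 5 × Fin 5)) :=
  ![[[(e1, e3)], [(e1, e4)], [(e1, e5)], [(e2, e3)], [(e2, e4)], [(e2, e5)], [(e3, e4)],
      [(e3, e5)], [(e4, e5)]],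
    [[(e1, e4)], [(e1, e5)], [(e2, e3)], [(e2, e5)], [(e3, e5)]],
    [[(e1, e4)], [(e1, e5)], [(e2, e3)], [(e2, e4)], [(e2, e5)], [(e3, e4)], [(e3, e5)]],
    [[(e1, e4)], [(e1, e5), (e2, e4)], [(e2, e5)]],
    [[(e1, e2)], [(e1, e3)], [(e1, e4)], [(e1, e5)], [(e2, e3)], [(e2, e4)], [(e2, e5)],
      [(e3, e5)], [(e4, e5)]],
    [[(e1, e3)], [(e1, e4)], [(e2, e4)], [(e2, e5)], [(e3, e4)]],
    [[(e1, e3)], [(e1, e4)], [(e2, e3)], [(e2, e4)]],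
    [[(e1, e5)], [(e2, e3)]],
    [[(e1, e4)], [(e1, e5), (e2, e4)]],
    []]

/-- The forms whose classes complete those of `pairsTM` to a basis of `H²_T(𝕋⁵_{n+1}, ℂ)`. -/
def pairsExtra : Fin 10 → List (List (Fin 5 × Fin 5)) :=
  ![[],
    [[(e2, e4)], [(e4, e5)]],
    [],
    [[(e1, e5)]],
    [],
    [[(e1, e5)], [(e4, e5)]],
    [],
    [[(e2, e4)], [(e2, e5)]],
    [[(e1, e5)], [(e2, e5)]],
    [[(e1, e4)], [(e2, e3)], [(e3, e4), (e1, e5)]]]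

/-- The bilinear forms `∑ Δ_{pq}` on `𝕋⁵_{n+1}` described by a list of lists of pairs. -/
def forms (n : Fin 10) (L : List (List (Fin 5 × Fin 5))) : List (LinearMap.BilinForm ℂ (T5 n)) :=
  L.map fun l => (l.map fun t => Delta n t.1 t.2).sum

end Tortkara

namespace Tortkara

/-! ### Computing in the ten algebras -/

/-! Existence rests on a flag. In a nilpotent algebra, outside every proper subspace `V` there is an
`x` with `Ax ⊆ V`. Starting from `V = 0` this yields a basis `e, d, c, b, a`, built in that order,
with `ab` in `⟨c,d,e⟩`, with `ac, bc` in `⟨d,e⟩`, with `ad, bd, cd` in `⟨e⟩`, and with `e`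
annihilating everything (`IsNilpotentAlgebra.exists_isFrame`). The product is then given by ten
scalars, which base changes bring to normal form (`IsFrame.exists_isIsomorphic`). If `ab = c` and
`ac`, `bc` do not both lie in `⟨e⟩`, one may take `ac = d`. The Tortkara identity then forces `cd =
0`; this is its only use, and 𝕋⁵₀₂, 𝕋⁵₀₄, 𝕋⁵₀₈, 𝕋⁵₀₉, 𝕋⁵₁₀ remain. If `ab = c` and all other
products are multiples of `e`, the result is 𝕋⁵₀₁, 𝕋⁵₀₂, 𝕋⁵₀₃, 𝕋⁵₀₆ or 𝕋⁵₀₇. A one-dimensional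
square amounts to a skew form of rank 2 or 4, giving 𝕋⁵₀₁ or 𝕋⁵₀₅. For uniqueness, four properties
(vanishing of `(xy)z`, vanishing of `((xy)z)w`, the Jacobi identity, rank at most 2 of all forms
`f(xy)`) separate all pairs except 𝕋⁵₀₁, 𝕋⁵₀₃ and 𝕋⁵₀₂, 𝕋⁵₀₄. These differ in the dimension of the
span of the products `xy`, respectively `(xy)z` (`T5_eq_of_isIsomorphic`). The cohomology is linear
algebra on the ten coefficients of a skew form. Cocycles are cut out by a few linear equations read
off from basis vectors, coboundaries are explicit, and `classesFormBasis_of_coeff` compares the two.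
-/

lemma forall_fin_ten {P : Fin 10 → Prop} (h0 : P 0) (h1 : P 1) (h2 : P 2) (h3 : P 3) (h4 : P 4)
    (h5 : P 5) (h6 : P 6) (h7 : P 7) (h8 : P 8) (h9 : P 9) (n : Fin 10) : P n := by
  fin_cases n <;> assumption

section Coordinates

variable {n : Fin 10}

@[ext] lemma T5.ext {x y : T5 n} (h0 : x 0 = y 0) (h1 : x 1 = y 1) (h2 : x 2 = y 2)
    (h3 : x 3 = y 3) (h4 : x 4 = y 4) : x = y := by
  funext k
  fin_cases k <;> assumption

@[simp] lemma T5.add_apply (x y : T5 n) (k : Fin 5) : (x + y) k = x k + y k := rfl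

@[simp] lemma T5.neg_apply (x : T5 n) (k : Fin 5) : (-x) k = -x k := rfl

@[simp] lemma T5.smul_apply (c : ℂ) (x : T5 n) (k : Fin 5) : (c • x) k = c * x k := rfl

@[simp] lemma T5.zero_apply (k : Fin 5) : (0 : T5 n) k = 0 := rfl

lemma T5.mul_apply (x y : T5 n) (k : Fin 5) : (x * y) k =
    ((table n).map fun t => if t.2.2 = k then Delta n t.1 t.2.1 x y else 0).sum := rfl

@[simp] lemma Delta_apply (p q : Fin 5) (x y : T5 n) :
    Delta n p q x y = x p * y q - x q * y p := rfl

/-- The algebra `T5 n` has the coordinates of `Fin 5 → ℂ`. -/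
def T5.coordEquiv (n : Fin 10) : T5 n ≃ₗ[ℂ] (Fin 5 → ℂ) := LinearEquiv.refl ℂ (Fin 5 → ℂ)

/-- The element of `T5 n` with given coordinates. -/
def vec (n : Fin 10) (a b c d e : ℂ) : T5 n := (![a, b, c, d, e] : Fin 5 → ℂ)

@[simp] lemma vec_coords (a b c d e : ℂ) : vec n a b c d e 0 = a ∧ vec n a b c d e 1 = b ∧
    vec n a b c d e 2 = c ∧ vec n a b c d e 3 = d ∧ vec n a b c d e 4 = e :=
  ⟨rfl, rfl, rfl, rfl, rfl⟩

/-- The basis vectors. -/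
def basisVec (n : Fin 10) (p : Fin 5) : T5 n := fun k => if k = p then 1 else 0

@[simp] lemma basisVec_apply (p k : Fin 5) : basisVec n p k = if k = p then 1 else 0 := rfl

lemma T5.eq_sum (x : T5 n) : x = x 0 • basisVec n 0 + x 1 • basisVec n 1 +
    x 2 • basisVec n 2 + x 3 • basisVec n 3 + x 4 • basisVec n 4 := by
  ext <;> simp

lemma mul_T5_0 (x y : T5 0) : x * y = vec 0 0 0 (x 0 * y 1 - x 1 * y 0) 0 0 := by
  ext <;> simp [T5.mul_apply, table, e1, e2, e3, e4, e5]

lemma mul_T5_1 (x y : T5 1) :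
    x * y = vec 1 0 0 (x 0 * y 1 - x 1 * y 0) (x 0 * y 2 - x 2 * y 0) 0 := by
  ext <;> simp [T5.mul_apply, table, e1, e2, e3, e4, e5]

lemma mul_T5_2 (x y : T5 2) :
    x * y = vec 2 0 0 0 (x 0 * y 1 - x 1 * y 0) (x 0 * y 2 - x 2 * y 0) := by
  ext <;> simp [T5.mul_apply, table, e1, e2, e3, e4, e5]

lemma mul_T5_3 (x y : T5 3) :
    x * y = vec 3 0 0 (x 0 * y 1 - x 1 * y 0) (x 0 * y 2 - x 2 * y 0) (x 1 * y 2 - x 2 * y 1) := by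
  ext <;> simp [T5.mul_apply, table, e1, e2, e3, e4, e5]

lemma mul_T5_4 (x y : T5 4) :
    x * y = vec 4 0 0 0 0 (x 0 * y 1 - x 1 * y 0 + (x 2 * y 3 - x 3 * y 2)) := by
  ext <;> simp [T5.mul_apply, table, e1, e2, e3, e4, e5]

lemma mul_T5_5 (x y : T5 5) : x * y =
    vec 5 0 0 (x 0 * y 1 - x 1 * y 0) 0 (x 0 * y 3 - x 3 * y 0 + (x 1 * y 2 - x 2 * y 1)) := by
  ext <;> simp [T5.mul_apply, table, e1, e2, e3, e4, e5]

lemma mul_T5_6 (x y : T5 6) :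
    x * y = vec 6 0 0 (x 0 * y 1 - x 1 * y 0) 0 (x 2 * y 3 - x 3 * y 2) := by
  ext <;> simp [T5.mul_apply, table, e1, e2, e3, e4, e5]

lemma mul_T5_7 (x y : T5 7) :
    x * y = vec 7 0 0 (x 0 * y 1 - x 1 * y 0) (x 0 * y 2 - x 2 * y 0) (x 0 * y 3 - x 3 * y 0) := by
  ext <;> simp [T5.mul_apply, table, e1, e2, e3, e4, e5]

lemma mul_T5_8 (x y : T5 8) : x * y = vec 8 0 0 (x 0 * y 1 - x 1 * y 0) (x 0 * y 2 - x 2 * y 0)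
    (x 0 * y 3 - x 3 * y 0 + (x 1 * y 2 - x 2 * y 1)) := by
  ext <;> simp [T5.mul_apply, table, e1, e2, e3, e4, e5]

lemma mul_T5_9 (x y : T5 9) :
    x * y = vec 9 0 0 (x 0 * y 1 - x 1 * y 0) (x 0 * y 2 - x 2 * y 0) (x 1 * y 3 - x 3 * y 1) := by
  ext <;> simp [T5.mul_apply, table, e1, e2, e3, e4, e5]

lemma T5.anticomm (x y : T5 n) : x * y = -(y * x) := by
  revert x y
  refine forall_fin_ten (P := fun n => ∀ x y : T5 n, x * y = -(y * x)) ?_ ?_ ?_ ?_ ?_ ?_ ?_ ?_ ?_ ?_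
    n <;> intro x y
  · ext <;> simp [mul_T5_0]
    ring
  · ext <;> simp [mul_T5_1] <;> ring
  · ext <;> simp [mul_T5_2] <;> ring
  · ext <;> simp [mul_T5_3] <;> ring
  · ext <;> simp [mul_T5_4]
    ring
  · ext <;> simp [mul_T5_5] <;> ring
  · ext <;> simp [mul_T5_6] <;> ring
  · ext <;> simp [mul_T5_7] <;> ring
  · ext <;> simp [mul_T5_8] <;> ring
  · ext <;> simp [mul_T5_9] <;> ring

end Coordinates

/-! ### The ten algebras: Tortkara identity, nilpotency, Malcev identity. -/

lemma finrank_T5 (n : Fin 10) : Module.finrank ℂ (T5 n) = 5 := by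
  rw [(T5.coordEquiv n).finrank_eq]
  simp

lemma isTortkara_T5 (n : Fin 10) : IsTortkara (T5 n) := by
  refine ⟨T5.anticomm, ?_⟩
  refine forall_fin_ten (P := fun n => ∀ a b c : T5 n, (a * b) * (c * b) = jacobian a b c * b)
    ?_ ?_ ?_ ?_ ?_ ?_ ?_ ?_ ?_ ?_ n <;> intro a b c
  · ext <;> simp [jacobian, mul_T5_0]
  · ext <;> simp [jacobian, mul_T5_1]
  · ext <;> simp [jacobian, mul_T5_2]
  · ext <;> simp [jacobian, mul_T5_3]
  · ext <;> simp [jacobian, mul_T5_4]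
  · ext <;> simp [jacobian, mul_T5_5]
  · ext <;> simp [jacobian, mul_T5_6]
  · ext <;> simp [jacobian, mul_T5_7]
    exact Or.inl (by ring)
  · ext <;> simp [jacobian, mul_T5_8]
    exact Or.inl (by ring)
  · ext <;> simp [jacobian, mul_T5_9]
    exact Or.inl (by ring)

lemma isNontrivialAlgebra_T5 (n : Fin 10) : IsNontrivialAlgebra (T5 n) := by
  refine ⟨basisVec n 0, basisVec n 1, ?_⟩
  have key : ∀ n : Fin 10, ∃ k, (basisVec n 0 * basisVec n 1) k ≠ 0 :=
    forall_fin_ten ⟨2, by simp [mul_T5_0]⟩ ⟨2, by simp [mul_T5_1]⟩ ⟨3, by simp [mul_T5_2]⟩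
      ⟨2, by simp [mul_T5_3]⟩ ⟨4, by simp [mul_T5_4]⟩ ⟨2, by simp [mul_T5_5]⟩
      ⟨2, by simp [mul_T5_6]⟩ ⟨2, by simp [mul_T5_7]⟩ ⟨2, by simp [mul_T5_8]⟩
      ⟨2, by simp [mul_T5_9]⟩
  obtain ⟨k, hk⟩ := key n
  exact fun h => hk (by rw [h]; rfl)

/-- Weights of the basis vectors for which all ten products are graded up to higher weight. -/
def weight : Fin 5 → ℕ := ![1, 1, 2, 3, 5]

/-- The weights 2 and 3 come from `e₁e₂ = e₃` and `e₁e₃ = e₄`, and 5 is needed for `e₃e₄ = e₅` in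
𝕋⁵₀₇. Asking only for an inequality lets one weight serve all ten tables. -/
lemma weight_table (n : Fin 10) :
    ∀ t ∈ table n, weight t.1 + weight t.2.1 ≤ weight t.2.2 := by
  fin_cases n <;> simp [table, weight, e1, e2, e3, e4, e5]

/-- Weights can only grow under multiplication, so `A^i A^j` involves only basis vectors of weight
at least `i + j`. -/
lemma apply_eq_zero_of_mem_power {n : Fin 10} (m : ℕ) :
    ∀ x ∈ power (T5 n) m, ∀ k, weight k < m → x k = 0 := by
  induction m using Nat.strong_induction_on with
  | _ m ih =>
    intro x hx k hk
    match m, ih, hx, hk with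
    | 0, _, _, hk => omega
    | 1, _, _, hk => exact absurd hk (by fin_cases k <;> decide)
    | m + 2, ih, hx, hk =>
      let S : Submodule ℂ (T5 n) :=
        { carrier := {x | x k = 0}
          zero_mem' := rfl
          add_mem' := fun {a b} (ha : a k = 0) (hb : b k = 0) => by
            change a k + b k = 0
            rw [ha, hb, add_zero]
          smul_mem' := fun c a (ha : a k = 0) => by
            change c * a k = 0
            rw [ha, mul_zero] }
      suffices h : power (T5 n) (m + 2) ≤ S from h hx
      rw [power]
      refine iSup_le fun i => Submodule.span_le.2 ?_
      rintro _ ⟨x, hx, y, hy, rfl⟩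
      change (x * y) k = 0
      have hi := i.2
      have hx' := ih (i + 1) (by omega) x hx
      have hy' := ih (m + 1 - i) (by omega) y hy
      rw [T5.mul_apply]
      refine List.sum_eq_zero fun z hz => ?_
      obtain ⟨t, ht, rfl⟩ := List.mem_map.1 hz
      split_ifs with h
      · subst h
        have hw := weight_table n t ht
        -- The exponents `i + 1` and `m + 1 - i` add up to `m + 2`, so one of the two weights is
        -- below the exponent of its factor.
        have aux : ∀ p q, weight p + weight q < m + 2 → x p * y q = 0 := fun p q hpq => by
          by_cases hp : weight p < i + 1
          · rw [hx' p hp, zero_mul]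
          · rw [hy' q (by omega), mul_zero]
        rw [Delta_apply, aux _ _ (by omega), aux _ _ (by omega), sub_zero]
      · rfl

lemma isNilpotentAlgebra_T5 (n : Fin 10) : IsNilpotentAlgebra (T5 n) := by
  -- The largest weight is 5.
  refine ⟨6, by norm_num, (Submodule.eq_bot_iff _).2 fun x hx => ?_⟩
  funext k
  exact apply_eq_zero_of_mem_power 6 x hx k (by revert k; decide)

lemma isMalcev_T5_iff (n : Fin 10) : IsMalcev (T5 n) ↔ n ≠ 9 := by
  constructor
  · rintro h rfl
    -- In 𝕋⁵₁₀, `J(e₁, e₂, e₁e₂) = e₂e₄ = e₅`, whereas `J(e₁, e₂, e₂) = 0`.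
    have := congrArg (fun x : T5 9 => x 4)
      (h.malcev (basisVec 9 0) (basisVec 9 1) (basisVec 9 1))
    simp [jacobian, mul_T5_9] at this
  · refine fun hn => ⟨T5.anticomm, ?_⟩
    revert hn
    refine forall_fin_ten (P := fun n => n ≠ 9 → ∀ a b c : T5 n,
      jacobian a b (a * c) = jacobian a b c * a) ?_ ?_ ?_ ?_ ?_ ?_ ?_ ?_ ?_ ?_ n <;> intro hn a b c
    · ext <;> simp [jacobian, mul_T5_0]
    · ext <;> simp [jacobian, mul_T5_1]
    · ext <;> simp [jacobian, mul_T5_2]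
    · ext <;> simp [jacobian, mul_T5_3]
    · ext <;> simp [jacobian, mul_T5_4]
    · ext <;> simp [jacobian, mul_T5_5]
    · ext <;> simp [jacobian, mul_T5_6]
    · ext <;> simp [jacobian, mul_T5_7]
      ring
    · ext <;> simp [jacobian, mul_T5_8]
      ring
    · exact absurd rfl hn

end Tortkara

namespace Tortkara

/-! ### Isomorphism invariants -/

section Invariants

lemma IsIsomorphic.symm {A B : Type*} [NonUnitalNonAssocRing A] [Module ℂ A]
    [NonUnitalNonAssocRing B] [Module ℂ B] (h : IsIsomorphic A B) : IsIsomorphic B A := by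
  obtain ⟨e, he⟩ := h
  refine ⟨e.symm, fun x y => e.injective ?_⟩
  rw [he, e.apply_symm_apply, e.apply_symm_apply, e.apply_symm_apply]

lemma IsIsomorphic.trans {A B C : Type*} [NonUnitalNonAssocRing A] [Module ℂ A]
    [NonUnitalNonAssocRing B] [Module ℂ B] [NonUnitalNonAssocRing C] [Module ℂ C]
    (h : IsIsomorphic A B) (h' : IsIsomorphic B C) : IsIsomorphic A C := by
  obtain ⟨e, he⟩ := h
  obtain ⟨e', he'⟩ := h'
  exact ⟨e.trans e', fun x y => by simp [he, he']⟩

variable (A : Type*) [NonUnitalNonAssocRing A] [Module ℂ A]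

/-- All products `(xy)z` vanish. -/
def TripleProductsVanish : Prop := ∀ x y z : A, x * y * z = 0

/-- All products `((xy)z)w` vanish. -/
def LeftQuadrupleProductsVanish : Prop := ∀ x y z w : A, x * y * z * w = 0

/-- The Jacobi identity. -/
def JacobiIdentity : Prop := ∀ x y z : A, jacobian x y z = 0

/-- For every linear form `f`, the form `(x, y) ↦ f (xy)` has rank at most `2`. -/
def PfaffiansVanish : Prop := ∀ (f : A →ₗ[ℂ] ℂ) (x y z t : A),
  f (x * y) * f (z * t) - f (x * z) * f (y * t) + f (x * t) * f (y * z) = 0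

/-- The products `xy` span a space of dimension at most `1`. -/
def ProductsProportional : Prop := ∀ (f g : A →ₗ[ℂ] ℂ) (x y z t : A),
  f (x * y) * g (z * t) = g (x * y) * f (z * t)

/-- The products `(xy)z` span a space of dimension at most `1`. -/
def TripleProductsProportional : Prop := ∀ (f g : A →ₗ[ℂ] ℂ) (x y z x' y' z' : A),
  f (x * y * z) * g (x' * y' * z') = g (x * y * z) * f (x' * y' * z')

variable {A} {B : Type*} [NonUnitalNonAssocRing B] [Module ℂ B]

lemma TripleProductsVanish.congr (h : IsIsomorphic A B) (hA : TripleProductsVanish A) :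
    TripleProductsVanish B := by
  obtain ⟨e, he⟩ := h.symm
  intro x y z
  apply e.injective
  simpa [he] using hA (e x) (e y) (e z)

lemma LeftQuadrupleProductsVanish.congr (h : IsIsomorphic A B) (hA : LeftQuadrupleProductsVanish A)
    : LeftQuadrupleProductsVanish B := by
  obtain ⟨e, he⟩ := h.symm
  intro x y z w
  apply e.injective
  simpa [he] using hA (e x) (e y) (e z) (e w)

lemma JacobiIdentity.congr (h : IsIsomorphic A B) (hA : JacobiIdentity A) : JacobiIdentity B := by
  obtain ⟨e, he⟩ := h.symm
  intro x y z
  apply e.injective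
  simpa [jacobian, he] using hA (e x) (e y) (e z)

lemma PfaffiansVanish.congr (h : IsIsomorphic A B) (hA : PfaffiansVanish A) : PfaffiansVanish
    B := by
  obtain ⟨e, he⟩ := h.symm
  intro f x y z t
  simpa [← he] using hA (f ∘ₗ e.symm.toLinearMap) (e x) (e y) (e z) (e t)

lemma ProductsProportional.congr (h : IsIsomorphic A B) (hA : ProductsProportional A) :
    ProductsProportional B := by
  obtain ⟨e, he⟩ := h.symm
  intro f g x y z t
  simpa [← he] using hA (f ∘ₗ e.symm.toLinearMap) (g ∘ₗ e.symm.toLinearMap) (e x) (e y) (e z) (e t)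

lemma TripleProductsProportional.congr (h : IsIsomorphic A B) (hA : TripleProductsProportional A) :
    TripleProductsProportional B := by
  obtain ⟨e, he⟩ := h.symm
  intro f g x y z x' y' z'
  simpa [← he] using hA (f ∘ₗ e.symm.toLinearMap) (g ∘ₗ e.symm.toLinearMap) (e x) (e y) (e z) (e
      x') (e y') (e z')

end Invariants

/-- The linear form with given coefficients. -/
def linForm (n : Fin 10) (a b c d e : ℂ) : T5 n →ₗ[ℂ] ℂ where
  toFun x := a * x 0 + b * x 1 + c * x 2 + d * x 3 + e * x 4
  map_add' x y := by simp only [T5.add_apply]; ring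
  map_smul' r x := by simp only [T5.smul_apply, smul_eq_mul, RingHom.id_apply]; ring

@[simp] lemma linForm_apply {n : Fin 10} (a b c d e : ℂ) (x : T5 n) :
    linForm n a b c d e x = a * x 0 + b * x 1 + c * x 2 + d * x 3 + e * x 4 := rfl

lemma exists_eq_linForm {n : Fin 10} (f : T5 n →ₗ[ℂ] ℂ) :
    ∃ a b c d e, f = linForm n a b c d e := by
  refine ⟨f (basisVec n 0), f (basisVec n 1), f (basisVec n 2), f (basisVec n 3),
    f (basisVec n 4), LinearMap.ext fun x => ?_⟩
  conv_lhs => rw [T5.eq_sum x]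
  simp only [map_add, map_smul, smul_eq_mul, linForm_apply]
  ring

/-! ### Values of the invariants on the ten algebras. -/

lemma tripleProductsVanish_T5_iff : ∀ n : Fin 10, TripleProductsVanish (T5 n) ↔
    n ∈ ({0, 2, 4} : Finset (Fin 10)) := by
  refine forall_fin_ten ?_ ?_ ?_ ?_ ?_ ?_ ?_ ?_ ?_ ?_
  · exact iff_of_true (fun x y z => by ext <;> simp [mul_T5_0]) (by decide)
  · refine iff_of_false (fun h => ?_) (by decide)
    have := congrArg (fun x : T5 1 => x 3) (h (basisVec 1 0) (basisVec 1 1) (basisVec 1 0))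
    simp [mul_T5_1] at this
  · exact iff_of_true (fun x y z => by ext <;> simp [mul_T5_2]) (by decide)
  · refine iff_of_false (fun h => ?_) (by decide)
    have := congrArg (fun x : T5 3 => x 3) (h (basisVec 3 0) (basisVec 3 1) (basisVec 3 0))
    simp [mul_T5_3] at this
  · exact iff_of_true (fun x y z => by ext <;> simp [mul_T5_4]) (by decide)
  · refine iff_of_false (fun h => ?_) (by decide)
    have := congrArg (fun x : T5 5 => x 4) (h (basisVec 5 0) (basisVec 5 1) (basisVec 5 1))
    simp [mul_T5_5] at this
  · refine iff_of_false (fun h => ?_) (by decide)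
    have := congrArg (fun x : T5 6 => x 4) (h (basisVec 6 0) (basisVec 6 1) (basisVec 6 3))
    simp [mul_T5_6] at this
  · refine iff_of_false (fun h => ?_) (by decide)
    have := congrArg (fun x : T5 7 => x 3) (h (basisVec 7 0) (basisVec 7 1) (basisVec 7 0))
    simp [mul_T5_7] at this
  · refine iff_of_false (fun h => ?_) (by decide)
    have := congrArg (fun x : T5 8 => x 3) (h (basisVec 8 0) (basisVec 8 1) (basisVec 8 0))
    simp [mul_T5_8] at this
  · refine iff_of_false (fun h => ?_) (by decide)
    have := congrArg (fun x : T5 9 => x 3) (h (basisVec 9 0) (basisVec 9 1) (basisVec 9 0))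
    simp [mul_T5_9] at this

lemma leftQuadrupleProductsVanish_T5_iff : ∀ n : Fin 10, LeftQuadrupleProductsVanish (T5 n) ↔
    n ∈ ({0, 1, 2, 3, 4, 5, 6} : Finset (Fin 10)) := by
  refine forall_fin_ten ?_ ?_ ?_ ?_ ?_ ?_ ?_ ?_ ?_ ?_
  · exact iff_of_true (fun x y z w => by ext <;> simp [mul_T5_0]) (by decide)
  · exact iff_of_true (fun x y z w => by ext <;> simp [mul_T5_1]) (by decide)
  · exact iff_of_true (fun x y z w => by ext <;> simp [mul_T5_2]) (by decide)
  · exact iff_of_true (fun x y z w => by ext <;> simp [mul_T5_3]) (by decide)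
  · exact iff_of_true (fun x y z w => by ext <;> simp [mul_T5_4]) (by decide)
  · exact iff_of_true (fun x y z w => by ext <;> simp [mul_T5_5]) (by decide)
  · exact iff_of_true (fun x y z w => by ext <;> simp [mul_T5_6]) (by decide)
  · refine iff_of_false (fun h => ?_) (by decide)
    have := congrArg (fun x : T5 7 => x 4) (h (basisVec 7 0) (basisVec 7 1) (basisVec 7 0)
        (basisVec 7 0))
    simp [mul_T5_7] at this
  · refine iff_of_false (fun h => ?_) (by decide)
    have := congrArg (fun x : T5 8 => x 4) (h (basisVec 8 0) (basisVec 8 1) (basisVec 8 0)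
        (basisVec 8 0))
    simp [mul_T5_8] at this
  · refine iff_of_false (fun h => ?_) (by decide)
    have := congrArg (fun x : T5 9 => x 4) (h (basisVec 9 0) (basisVec 9 1) (basisVec 9 0)
        (basisVec 9 1))
    simp [mul_T5_9] at this

lemma jacobiIdentity_T5_iff : ∀ n : Fin 10, JacobiIdentity (T5 n) ↔
    n ∈ ({0, 1, 2, 3, 4, 5, 7, 8} : Finset (Fin 10)) := by
  refine forall_fin_ten ?_ ?_ ?_ ?_ ?_ ?_ ?_ ?_ ?_ ?_
  · exact iff_of_true (fun x y z => by ext <;> simp [jacobian, mul_T5_0]) (by decide)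
  · exact iff_of_true (fun x y z => by ext <;> simp [jacobian, mul_T5_1]; ring) (by decide)
  · exact iff_of_true (fun x y z => by ext <;> simp [jacobian, mul_T5_2]) (by decide)
  · exact iff_of_true (fun x y z => by ext <;> simp [jacobian, mul_T5_3] <;> ring) (by decide)
  · exact iff_of_true (fun x y z => by ext <;> simp [jacobian, mul_T5_4]) (by decide)
  · exact iff_of_true (fun x y z => by ext <;> simp [jacobian, mul_T5_5]; ring) (by decide)
  · refine iff_of_false (fun h => ?_) (by decide)
    have := congrArg (fun x : T5 6 => x 4) (h (basisVec 6 0) (basisVec 6 1) (basisVec 6 3))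
    simp [jacobian, mul_T5_6] at this
  · exact iff_of_true (fun x y z => by ext <;> simp [jacobian, mul_T5_7] <;> ring) (by decide)
  · exact iff_of_true (fun x y z => by ext <;> simp [jacobian, mul_T5_8] <;> ring) (by decide)
  · refine iff_of_false (fun h => ?_) (by decide)
    have := congrArg (fun x : T5 9 => x 4) (h (basisVec 9 0) (basisVec 9 1) (basisVec 9 2))
    simp [jacobian, mul_T5_9] at this

lemma pfaffiansVanish_T5_iff : ∀ n : Fin 10, PfaffiansVanish (T5 n) ↔
    n ∈ ({0, 1, 2, 3, 7} : Finset (Fin 10)) := by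
  refine forall_fin_ten ?_ ?_ ?_ ?_ ?_ ?_ ?_ ?_ ?_ ?_
  · refine iff_of_true (fun f x y z t => ?_) (by decide)
    obtain ⟨a1, b1, c1, d1, e1, rfl⟩ := exists_eq_linForm f
    simp only [linForm_apply, mul_T5_0, vec_coords]
    ring
  · refine iff_of_true (fun f x y z t => ?_) (by decide)
    obtain ⟨a1, b1, c1, d1, e1, rfl⟩ := exists_eq_linForm f
    simp only [linForm_apply, mul_T5_1, vec_coords]
    ring
  · refine iff_of_true (fun f x y z t => ?_) (by decide)
    obtain ⟨a1, b1, c1, d1, e1, rfl⟩ := exists_eq_linForm f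
    simp only [linForm_apply, mul_T5_2, vec_coords]
    ring
  · refine iff_of_true (fun f x y z t => ?_) (by decide)
    obtain ⟨a1, b1, c1, d1, e1, rfl⟩ := exists_eq_linForm f
    simp only [linForm_apply, mul_T5_3, vec_coords]
    ring
  · refine iff_of_false (fun h => ?_) (by decide)
    have := h (linForm 4 0 0 0 0 1) (basisVec 4 0) (basisVec 4 1) (basisVec 4 2) (basisVec 4 3)
    simp [mul_T5_4] at this
  · refine iff_of_false (fun h => ?_) (by decide)
    have := h (linForm 5 0 0 0 0 1) (basisVec 5 0) (basisVec 5 1) (basisVec 5 2) (basisVec 5 3)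
    simp [mul_T5_5] at this
  · refine iff_of_false (fun h => ?_) (by decide)
    -- A single coordinate only gives rank 2. The sum of the third and fifth gives `Δ₁₂ + Δ₃₄`, of
    -- rank 4.
    have := h (linForm 6 0 0 1 0 1) (basisVec 6 0) (basisVec 6 1) (basisVec 6 2) (basisVec 6 3)
    simp [mul_T5_6] at this
  · refine iff_of_true (fun f x y z t => ?_) (by decide)
    obtain ⟨a1, b1, c1, d1, e1, rfl⟩ := exists_eq_linForm f
    simp only [linForm_apply, mul_T5_7, vec_coords]
    ring
  · refine iff_of_false (fun h => ?_) (by decide)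
    have := h (linForm 8 0 0 0 0 1) (basisVec 8 0) (basisVec 8 1) (basisVec 8 2) (basisVec 8 3)
    simp [mul_T5_8] at this
  · refine iff_of_false (fun h => ?_) (by decide)
    -- Here the fourth and fifth coordinates together give `Δ₁₃ + Δ₂₄`.
    have := h (linForm 9 0 0 0 1 1) (basisVec 9 0) (basisVec 9 1) (basisVec 9 2) (basisVec 9 3)
    simp [mul_T5_9] at this

lemma productsProportional_T5_0 : ProductsProportional (T5 0) := by
  intro f g x y z t
  obtain ⟨a1, b1, c1, d1, e1, rfl⟩ := exists_eq_linForm f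
  obtain ⟨a2, b2, c2, d2, e2, rfl⟩ := exists_eq_linForm g
  simp only [linForm_apply, mul_T5_0, vec_coords]
  ring

lemma not_productsProportional_T5_2 : ¬ProductsProportional (T5 2) := fun h => by
  have := h (linForm 2 0 0 0 1 0) (linForm 2 0 0 0 0 1) (basisVec 2 0) (basisVec 2 1)
    (basisVec 2 0) (basisVec 2 2)
  simp [mul_T5_2] at this

lemma tripleProductsProportional_T5_1 : TripleProductsProportional (T5 1) := by
  intro f g x y z x' y' z'
  obtain ⟨a1, b1, c1, d1, e1, rfl⟩ := exists_eq_linForm f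
  obtain ⟨a2, b2, c2, d2, e2, rfl⟩ := exists_eq_linForm g
  simp only [linForm_apply, mul_T5_1, vec_coords]
  ring

lemma not_tripleProductsProportional_T5_3 : ¬TripleProductsProportional (T5 3) := fun h => by
  have := h (linForm 3 0 0 0 1 0) (linForm 3 0 0 0 0 1) (basisVec 3 0) (basisVec 3 1)
    (basisVec 3 0) (basisVec 3 0) (basisVec 3 1) (basisVec 3 1)
  simp [mul_T5_3] at this

/-- The first four invariants confuse only the indices 0, 2 and 1, 3; `h4` to `h7` exclude these
pairs in both orders. The rest is a check of finite sets over all pairs of indices. -/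
lemma T5_eq_of_isIsomorphic {n m : Fin 10} (h : IsIsomorphic (T5 n) (T5 m)) : n = m := by
  have h0 := (tripleProductsVanish_T5_iff n).symm.trans
    ((Iff.intro (.congr h) (.congr h.symm)).trans (tripleProductsVanish_T5_iff m))
  have h1 := (leftQuadrupleProductsVanish_T5_iff n).symm.trans
    ((Iff.intro (.congr h) (.congr h.symm)).trans (leftQuadrupleProductsVanish_T5_iff m))
  have h2 := (jacobiIdentity_T5_iff n).symm.trans
    ((Iff.intro (.congr h) (.congr h.symm)).trans (jacobiIdentity_T5_iff m))
  have h3 := (pfaffiansVanish_T5_iff n).symm.trans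
    ((Iff.intro (.congr h) (.congr h.symm)).trans (pfaffiansVanish_T5_iff m))
  have h4 : ¬(n = 0 ∧ m = 2) := by
    rintro ⟨rfl, rfl⟩
    exact not_productsProportional_T5_2 (productsProportional_T5_0.congr h)
  have h5 : ¬(n = 2 ∧ m = 0) := by
    rintro ⟨rfl, rfl⟩
    exact not_productsProportional_T5_2 (productsProportional_T5_0.congr h.symm)
  have h6 : ¬(n = 1 ∧ m = 3) := by
    rintro ⟨rfl, rfl⟩
    exact not_tripleProductsProportional_T5_3 (tripleProductsProportional_T5_1.congr h)
  have h7 : ¬(n = 3 ∧ m = 1) := by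
    rintro ⟨rfl, rfl⟩
    exact not_tripleProductsProportional_T5_3 (tripleProductsProportional_T5_1.congr h.symm)
  clear h
  revert n m
  set_option synthInstance.maxSize 1000 in
  decide

end Tortkara

namespace Tortkara

/-! ### The second cohomology spaces -/

/-- The quotient is eliminated: independence and spanning of classes become statements about values
of forms up to a term `f (x * y)`. -/
lemma classesFormBasis_ofFn {A : Type*} [NonUnitalNonAssocRing A] [Module ℂ A] {m : ℕ}
    (v : Fin m → LinearMap.BilinForm ℂ A) (Z : Submodule ℂ (LinearMap.BilinForm ℂ A))
    (hv : ∀ k, v k ∈ Z)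
    (hli : ∀ (g : Fin m → ℂ) (f : A →ₗ[ℂ] ℂ),
      (∀ x y, ∑ k, g k * v k x y = f (x * y)) → ∀ k, g k = 0)
    (hspan : ∀ θ ∈ Z, ∃ (g : Fin m → ℂ) (f : A →ₗ[ℂ] ℂ),
      ∀ x y, θ x y = ∑ k, g k * v k x y + f (x * y)) :
    ClassesFormBasis A (List.ofFn v) (Z.map (cohomologyClass A)) := by
  have hsum : ∀ g : Fin m → ℂ, ∀ x y, (∑ k, g k • v k) x y = ∑ k, g k * v k x y := by
    intro g x y
    simp [LinearMap.sum_apply]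
  have key : ∀ k : Fin (List.ofFn v).length,
      (List.ofFn v).get k = v (Fin.cast (List.length_ofFn) k) := fun k => List.get_ofFn v k
  have hrange : Set.range (fun k : Fin (List.ofFn v).length => cohomologyClass A ((List.ofFn v).get
      k))
      = Set.range fun k => cohomologyClass A (v k) := by
    simp only [key]
    exact (finCongr (List.length_ofFn (f := v))).surjective.range_comp
      (fun k => cohomologyClass A (v k))
  refine ⟨?_, ?_⟩
  · simp only [key]
    refine LinearIndependent.comp (v := fun k => cohomologyClass A (v k)) ?_ _
      (finCongr (List.length_ofFn (f := v))).injective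
    rw [Fintype.linearIndependent_iff]
    intro g hg
    have hg' : cohomologyClass A (∑ k, g k • v k) = 0 := by simpa using hg
    obtain ⟨f, hf⟩ := (Submodule.Quotient.mk_eq_zero _).1 hg'
    exact hli g f fun x y => by rw [← hf, hsum]
  · rw [hrange]
    refine le_antisymm (Submodule.span_le.2 ?_) ?_
    · rintro _ ⟨k, rfl⟩
      exact Submodule.mem_map_of_mem (hv k)
    · rintro _ ⟨θ, hθ, rfl⟩
      obtain ⟨g, f, h⟩ := hspan θ hθ
      have : cohomologyClass A θ = cohomologyClass A (∑ k, g k • v k) := by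
        refine (Submodule.Quotient.eq _).2 ⟨f, fun x y => ?_⟩
        rw [LinearMap.sub_apply, LinearMap.sub_apply, hsum, h]
        ring
      rw [this, map_sum]
      refine Submodule.sum_mem _ fun k _ => ?_
      rw [map_smul]
      exact Submodule.smul_mem _ _ (Submodule.subset_span ⟨k, rfl⟩)

/-- The skew-symmetric form with given coefficients, in the lexicographic order of the pairs. -/
def skewForm (n : Fin 10) (t : Fin 10 → ℂ) : LinearMap.BilinForm ℂ (T5 n) :=
  t 0 • Delta n 0 1 + t 1 • Delta n 0 2 + t 2 • Delta n 0 3 + t 3 • Delta n 0 4 +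
    t 4 • Delta n 1 2 + t 5 • Delta n 1 3 + t 6 • Delta n 1 4 + t 7 • Delta n 2 3 +
    t 8 • Delta n 2 4 + t 9 • Delta n 3 4

lemma skewForm_apply {n : Fin 10} (t : Fin 10 → ℂ) (x y : T5 n) : skewForm n t x y =
    t 0 * (x 0 * y 1 - x 1 * y 0) + t 1 * (x 0 * y 2 - x 2 * y 0) +
    t 2 * (x 0 * y 3 - x 3 * y 0) + t 3 * (x 0 * y 4 - x 4 * y 0) +
    t 4 * (x 1 * y 2 - x 2 * y 1) + t 5 * (x 1 * y 3 - x 3 * y 1) +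
    t 6 * (x 1 * y 4 - x 4 * y 1) + t 7 * (x 2 * y 3 - x 3 * y 2) +
    t 8 * (x 2 * y 4 - x 4 * y 2) + t 9 * (x 3 * y 4 - x 4 * y 3) := rfl

lemma skewForm_skew {n : Fin 10} (t : Fin 10 → ℂ) (x y : T5 n) :
    skewForm n t x y = -skewForm n t y x := by
  simp only [skewForm_apply]
  ring

lemma skewForm_injective (n : Fin 10) : Function.Injective (skewForm n) := by
  intro s t h
  have h' : ∀ x y, skewForm n s x y = skewForm n t x y := fun x y => by rw [h]
  simp only [skewForm_apply] at h'
  funext k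
  fin_cases k
  · simpa using h' (basisVec n 0) (basisVec n 1)
  · simpa using h' (basisVec n 0) (basisVec n 2)
  · simpa using h' (basisVec n 0) (basisVec n 3)
  · simpa using h' (basisVec n 0) (basisVec n 4)
  · simpa using h' (basisVec n 1) (basisVec n 2)
  · simpa using h' (basisVec n 1) (basisVec n 3)
  · simpa using h' (basisVec n 1) (basisVec n 4)
  · simpa using h' (basisVec n 2) (basisVec n 3)
  · simpa using h' (basisVec n 2) (basisVec n 4)
  · simpa using h' (basisVec n 3) (basisVec n 4)

lemma exists_eq_skewForm {n : Fin 10} {θ : LinearMap.BilinForm ℂ (T5 n)}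
    (h : ∀ x y, θ x y = -θ y x) : ∃ t, θ = skewForm n t := by
  -- Skew-symmetric forms are alternating because the characteristic is not 2.
  have hd : ∀ x, θ x x = 0 := fun x => self_eq_neg.1 (h x x)
  let b := basisVec n
  refine ⟨![θ (b 0) (b 1), θ (b 0) (b 2), θ (b 0) (b 3), θ (b 0) (b 4), θ (b 1) (b 2),
    θ (b 1) (b 3), θ (b 1) (b 4), θ (b 2) (b 3), θ (b 2) (b 4), θ (b 3) (b 4)],
    LinearMap.ext₂ fun x y => ?_⟩
  have hx : ∀ x : T5 n, x = x 0 • b 0 + x 1 • b 1 + x 2 • b 2 + x 3 • b 3 + x 4 • b 4 := T5.eq_sum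
  conv_lhs => rw [hx x, hx y]
  simp only [map_add, map_smul, LinearMap.add_apply, LinearMap.smul_apply, smul_eq_mul, hd,
    h (b 1) (b 0), h (b 2) (b 0), h (b 3) (b 0), h (b 4) (b 0), h (b 2) (b 1), h (b 3) (b 1),
    h (b 4) (b 1), h (b 3) (b 2), h (b 4) (b 2), h (b 4) (b 3)]
  simp [skewForm_apply]
  ring

/-- Serves 𝕋⁵₀₁, 𝕋⁵₀₃, 𝕋⁵₀₅, 𝕋⁵₀₇, for which the Malcev condition adds no equation. -/
lemma cohomologyT_eq_cohomologyTM {n : Fin 10}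
    (h : ∀ t, skewForm n t ∈ cocyclesT (T5 n) ↔ skewForm n t ∈ cocyclesTM (T5 n)) :
    cohomologyT (T5 n) = cohomologyTM (T5 n) := by
  have : cocyclesT (T5 n) = cocyclesTM (T5 n) := by
    refine le_antisymm (fun θ hθ => ?_) fun θ hθ => hθ.1
    obtain ⟨t, rfl⟩ := exists_eq_skewForm hθ.1
    exact (h t).1 hθ
  rw [cohomologyT, cohomologyTM, this]

/-- The coefficients of the coboundary of the linear form with coefficients `c`. -/
def coboundaryCoeff : Fin 10 → (Fin 5 → ℂ) → Fin 10 → ℂ :=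
  ![fun c => ![c 2, 0, 0, 0, 0, 0, 0, 0, 0, 0],
    fun c => ![c 2, c 3, 0, 0, 0, 0, 0, 0, 0, 0],
    fun c => ![c 3, c 4, 0, 0, 0, 0, 0, 0, 0, 0],
    fun c => ![c 2, c 3, 0, 0, c 4, 0, 0, 0, 0, 0],
    fun c => ![c 4, 0, 0, 0, 0, 0, 0, c 4, 0, 0],
    fun c => ![c 2, 0, c 4, 0, c 4, 0, 0, 0, 0, 0],
    fun c => ![c 2, 0, 0, 0, 0, 0, 0, c 4, 0, 0],
    fun c => ![c 2, c 3, c 4, 0, 0, 0, 0, 0, 0, 0],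
    fun c => ![c 2, c 3, c 4, 0, c 4, 0, 0, 0, 0, 0],
    fun c => ![c 2, c 3, 0, 0, 0, c 4, 0, 0, 0, 0]]

lemma linForm_mul (n : Fin 10) (c : Fin 5 → ℂ) (x y : T5 n) :
    linForm n (c 0) (c 1) (c 2) (c 3) (c 4) (x * y) = skewForm n (coboundaryCoeff n c) x y := by
  revert x y
  refine forall_fin_ten (P := fun n => ∀ x y : T5 n, linForm n (c 0) (c 1) (c 2) (c 3) (c 4) (x * y)
    = skewForm n (coboundaryCoeff n c) x y) ?_ ?_ ?_ ?_ ?_ ?_ ?_ ?_ ?_ ?_ n <;> intro x y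
  · simp [mul_T5_0, skewForm_apply, coboundaryCoeff]
  · simp [mul_T5_1, skewForm_apply, coboundaryCoeff]
  · simp [mul_T5_2, skewForm_apply, coboundaryCoeff]
  · simp [mul_T5_3, skewForm_apply, coboundaryCoeff]
  · simp [mul_T5_4, skewForm_apply, coboundaryCoeff]
    ring
  · simp [mul_T5_5, skewForm_apply, coboundaryCoeff]
    ring
  · simp [mul_T5_6, skewForm_apply, coboundaryCoeff]
  · simp [mul_T5_7, skewForm_apply, coboundaryCoeff]
  · simp [mul_T5_8, skewForm_apply, coboundaryCoeff]
    ring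
  · simp [mul_T5_9, skewForm_apply, coboundaryCoeff]

/-- A criterion in terms of coefficients: the cocycles are cut out by `K`, and the combinations of
the forms `v` have the coefficients `L`. -/
lemma classesFormBasis_of_coeff {n : Fin 10} {m : ℕ} (v : Fin m → LinearMap.BilinForm ℂ (T5 n))
    {l : List (LinearMap.BilinForm ℂ (T5 n))} (hl : l = List.ofFn v)
    {Z : Submodule ℂ (LinearMap.BilinForm ℂ (T5 n))} (hZ : ∀ θ ∈ Z, ∀ x y, θ x y = -θ y x)
    {K : (Fin 10 → ℂ) → Prop} (hK : ∀ t, skewForm n t ∈ Z ↔ K t)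
    (L : (Fin m → ℂ) → Fin 10 → ℂ)
    (hL : ∀ g x y, ∑ k, g k * v k x y = skewForm n (L g) x y)
    (hLK : ∀ g, K (L g))
    (hli : ∀ g c, L g = coboundaryCoeff n c → ∀ k, g k = 0)
    (hspan : ∀ t, K t → ∃ g c, t = L g + coboundaryCoeff n c) :
    ClassesFormBasis (T5 n) l (Z.map (cohomologyClass (T5 n))) := by
  subst hl
  refine classesFormBasis_ofFn v Z (fun k => ?_) (fun g f h => ?_) fun θ hθ => ?_
  -- The form `v k` is the combination with the `k`-th unit vector as coefficients, so `hLK` makes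
  -- it a cocycle.
  · have : v k = skewForm n (L (Pi.single k 1)) := LinearMap.ext₂ fun x y => by
      rw [← hL]
      simp [Pi.single_apply]
    rw [this, hK]
    exact hLK _
  · obtain ⟨a, b, c, d, e, rfl⟩ := exists_eq_linForm f
    refine hli g ![a, b, c, d, e] (skewForm_injective n (LinearMap.ext₂ fun x y => ?_))
    rw [← hL, h, ← linForm_mul]
    rfl
  · obtain ⟨t, rfl⟩ := exists_eq_skewForm (hZ θ hθ)
    obtain ⟨g, c, rfl⟩ := hspan t ((hK t).1 hθ)
    refine ⟨g, linForm n (c 0) (c 1) (c 2) (c 3) (c 4), fun x y => ?_⟩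
    rw [hL, linForm_mul]
    simp only [skewForm_apply, Pi.add_apply]
    ring

/-! ### Cocycle conditions as linear equations in the coefficients. -/

lemma skewForm_mem_cocyclesT_0 (t : Fin 10 → ℂ) :
    skewForm 0 t ∈ cocyclesT (T5 0) ↔ True := by
  refine ⟨fun _ => trivial, fun _ => ⟨skewForm_skew t, fun x y z w => ?_⟩⟩
  simp [jacobian, mul_T5_0, skewForm_apply]

lemma skewForm_mem_cocyclesTM_0 (t : Fin 10 → ℂ) :
    skewForm 0 t ∈ cocyclesTM (T5 0) ↔ True := by
  refine ⟨fun ⟨hT, h⟩ => ?_, fun _ => ⟨(skewForm_mem_cocyclesT_0 t).2 trivial, fun x y z w => ?_⟩⟩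
  · trivial
  · simp [mul_T5_0, skewForm_apply]

/-- As for the other algebras, necessity comes from quadruples of basis vectors that isolate the
coefficients. For sufficiency the linear equations turn the cocycle identity into a polynomial
identity in the coordinates. -/
lemma skewForm_mem_cocyclesT_1 (t : Fin 10 → ℂ) :
    skewForm 1 t ∈ cocyclesT (T5 1) ↔ t 7 = 0 := by
  refine ⟨fun ⟨_, h⟩ => ?_, fun h0 => ⟨skewForm_skew t, fun x y z w => ?_⟩⟩
  -- Both Jacobians vanish, and only `θ(e₁e₃, e₂e₁) = θ(e₃, e₄)` survives.
  · have := h (basisVec 1 0) (basisVec 1 0) (basisVec 1 1) (basisVec 1 2)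
    simp [jacobian, mul_T5_1, skewForm_apply] at this
    grind
  · simp only [jacobian, mul_T5_1, skewForm_apply, h0, vec_coords, T5.add_apply]
    ring

lemma skewForm_mem_cocyclesTM_1 (t : Fin 10 → ℂ) :
    skewForm 1 t ∈ cocyclesTM (T5 1) ↔ t 7 = 0 ∧ t 5 = 0 ∧ t 9 = 0 := by
  refine ⟨fun ⟨hT, h⟩ => ?_, fun h => ⟨(skewForm_mem_cocyclesT_1 t).2 ?_, fun x y z w => ?_⟩⟩
  · obtain h0 := (skewForm_mem_cocyclesT_1 t).1 hT
    refine ⟨h0, ?_, ?_⟩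
    · have := h (basisVec 1 0) (basisVec 1 0) (basisVec 1 1) (basisVec 1 1)
      simp [mul_T5_1, skewForm_apply] at this
      grind
    · have := h (basisVec 1 0) (basisVec 1 0) (basisVec 1 4) (basisVec 1 1)
      simp [mul_T5_1, skewForm_apply] at this
      grind
  · obtain ⟨h0, h1, h2⟩ := h
    exact h0
  · obtain ⟨h0, h1, h2⟩ := h
    simp only [mul_T5_1, skewForm_apply, h0, h1, h2, vec_coords]
    ring

lemma skewForm_mem_cocyclesT_2 (t : Fin 10 → ℂ) :
    skewForm 2 t ∈ cocyclesT (T5 2) ↔ t 9 = 0 := by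
  refine ⟨fun ⟨_, h⟩ => ?_, fun h0 => ⟨skewForm_skew t, fun x y z w => ?_⟩⟩
  · have := h (basisVec 2 0) (basisVec 2 0) (basisVec 2 1) (basisVec 2 2)
    simp [jacobian, mul_T5_2, skewForm_apply] at this
    grind
  · simp only [jacobian, mul_T5_2, skewForm_apply, h0, vec_coords, T5.add_apply]
    ring

lemma skewForm_mem_cocyclesTM_2 (t : Fin 10 → ℂ) :
    skewForm 2 t ∈ cocyclesTM (T5 2) ↔ t 9 = 0 := by
  refine ⟨fun ⟨hT, h⟩ => ?_, fun h => ⟨(skewForm_mem_cocyclesT_2 t).2 ?_, fun x y z w => ?_⟩⟩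
  · exact (skewForm_mem_cocyclesT_2 t).1 hT
  · exact h
  · simp [mul_T5_2, skewForm_apply, h]

lemma skewForm_mem_cocyclesT_3 (t : Fin 10 → ℂ) :
    skewForm 3 t ∈ cocyclesT (T5 3) ↔ t 7 = 0 ∧ t 8 = 0 ∧ t 9 = 0 := by
  refine ⟨fun ⟨_, h⟩ => ⟨?_, ?_, ?_⟩, fun ⟨h0, h1, h2⟩ => ⟨skewForm_skew t, fun x y z w => ?_⟩⟩
  · have := h (basisVec 3 0) (basisVec 3 0) (basisVec 3 1) (basisVec 3 2)
    simp [jacobian, mul_T5_3, skewForm_apply] at this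
    grind
  · have := h (basisVec 3 0) (basisVec 3 1) (basisVec 3 1) (basisVec 3 2)
    simp [jacobian, mul_T5_3, skewForm_apply] at this
    grind
  · have := h (basisVec 3 0) (basisVec 3 1) (basisVec 3 2) (basisVec 3 2)
    simp [jacobian, mul_T5_3, skewForm_apply] at this
    grind
  · simp only [jacobian, mul_T5_3, skewForm_apply, h0, h1, h2, vec_coords, T5.add_apply]
    ring

lemma skewForm_mem_cocyclesTM_3 (t : Fin 10 → ℂ) :
    skewForm 3 t ∈ cocyclesTM (T5 3) ↔ t 7 = 0 ∧ t 8 = 0 ∧ t 9 = 0 ∧ t 3 = t 5 := by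
  refine ⟨fun ⟨hT, h⟩ => ?_, fun h => ⟨(skewForm_mem_cocyclesT_3 t).2 ?_, fun x y z w => ?_⟩⟩
  · obtain ⟨h0, h1, h2⟩ := (skewForm_mem_cocyclesT_3 t).1 hT
    refine ⟨h0, h1, h2, ?_⟩
    -- This reads `0 = θ(e₄, e₂) + θ(-e₅, e₁)`, which is why `Δ₁₅` and `Δ₂₄` occur only together.
    · have := h (basisVec 3 0) (basisVec 3 0) (basisVec 3 1) (basisVec 3 1)
      simp [mul_T5_3, skewForm_apply] at this
      grind
  · obtain ⟨h0, h1, h2, h3⟩ := h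
    exact ⟨h0, h1, h2⟩
  · obtain ⟨h0, h1, h2, h3⟩ := h
    simp only [mul_T5_3, skewForm_apply, h0, h1, h2, h3, vec_coords]
    ring

lemma skewForm_mem_cocyclesT_4 (t : Fin 10 → ℂ) :
    skewForm 4 t ∈ cocyclesT (T5 4) ↔ True := by
  refine ⟨fun _ => trivial, fun _ => ⟨skewForm_skew t, fun x y z w => ?_⟩⟩
  simp [jacobian, mul_T5_4, skewForm_apply]

lemma skewForm_mem_cocyclesTM_4 (t : Fin 10 → ℂ) :
    skewForm 4 t ∈ cocyclesTM (T5 4) ↔ True := by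
  refine ⟨fun ⟨hT, h⟩ => ?_, fun _ => ⟨(skewForm_mem_cocyclesT_4 t).2 trivial, fun x y z w => ?_⟩⟩
  · trivial
  · simp [mul_T5_4, skewForm_apply]

lemma skewForm_mem_cocyclesT_5 (t : Fin 10 → ℂ) :
    skewForm 5 t ∈ cocyclesT (T5 5) ↔ t 8 = 0 := by
  refine ⟨fun ⟨_, h⟩ => ?_, fun h0 => ⟨skewForm_skew t, fun x y z w => ?_⟩⟩
  · have := h (basisVec 5 0) (basisVec 5 0) (basisVec 5 1) (basisVec 5 3)
    simp [jacobian, mul_T5_5, skewForm_apply] at this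
    grind
  · simp only [jacobian, mul_T5_5, skewForm_apply, h0, vec_coords, T5.add_apply]
    ring

lemma skewForm_mem_cocyclesTM_5 (t : Fin 10 → ℂ) :
    skewForm 5 t ∈ cocyclesTM (T5 5) ↔ t 8 = 0 ∧ t 3 = 0 ∧ t 9 = 0 := by
  refine ⟨fun ⟨hT, h⟩ => ?_, fun h => ⟨(skewForm_mem_cocyclesT_5 t).2 ?_, fun x y z w => ?_⟩⟩
  · obtain h0 := (skewForm_mem_cocyclesT_5 t).1 hT
    refine ⟨h0, ?_, ?_⟩
    · have := h (basisVec 5 0) (basisVec 5 0) (basisVec 5 1) (basisVec 5 1)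
      simp [mul_T5_5, skewForm_apply] at this
      grind
    · have := h (basisVec 5 0) (basisVec 5 1) (basisVec 5 1) (basisVec 5 3)
      simp [mul_T5_5, skewForm_apply] at this
      grind
  · obtain ⟨h0, h1, h2⟩ := h
    exact h0
  · obtain ⟨h0, h1, h2⟩ := h
    simp only [mul_T5_5, skewForm_apply, h0, h1, h2, vec_coords]
    ring

lemma skewForm_mem_cocyclesT_6 (t : Fin 10 → ℂ) :
    skewForm 6 t ∈ cocyclesT (T5 6) ↔ t 3 = 0 ∧ t 6 = 0 ∧ t 8 = 0 ∧ t 9 = 0 := by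
  refine ⟨fun ⟨_, h⟩ => ⟨?_, ?_, ?_, ?_⟩, fun ⟨h0, h1, h2, h3⟩ => ⟨skewForm_skew t, fun x y z
      w => ?_⟩⟩
  · have := h (basisVec 6 0) (basisVec 6 0) (basisVec 6 1) (basisVec 6 3)
    simp [jacobian, mul_T5_6, skewForm_apply] at this
    grind
  · have := h (basisVec 6 0) (basisVec 6 1) (basisVec 6 1) (basisVec 6 3)
    simp [jacobian, mul_T5_6, skewForm_apply] at this
    grind
  · have := h (basisVec 6 0) (basisVec 6 1) (basisVec 6 2) (basisVec 6 3)
    simp [jacobian, mul_T5_6, skewForm_apply] at this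
    grind
  · have := h (basisVec 6 0) (basisVec 6 1) (basisVec 6 3) (basisVec 6 3)
    simp [jacobian, mul_T5_6, skewForm_apply] at this
    grind
  · simp only [jacobian, mul_T5_6, skewForm_apply, h0, h1, h2, h3, vec_coords, T5.add_apply]
    ring

lemma skewForm_mem_cocyclesTM_6 (t : Fin 10 → ℂ) :
    skewForm 6 t ∈ cocyclesTM (T5 6) ↔ t 3 = 0 ∧ t 6 = 0 ∧ t 8 = 0 ∧ t 9 = 0 := by
  refine ⟨fun ⟨hT, h⟩ => ?_, fun h => ⟨(skewForm_mem_cocyclesT_6 t).2 ?_, fun x y z w => ?_⟩⟩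
  · exact (skewForm_mem_cocyclesT_6 t).1 hT
  · exact h
  · obtain ⟨h0, h1, h2, h3⟩ := h
    simp only [mul_T5_6, skewForm_apply, h0, h1, h2, h3, vec_coords]
    ring

lemma skewForm_mem_cocyclesT_7 (t : Fin 10 → ℂ) :
    skewForm 7 t ∈ cocyclesT (T5 7) ↔ t 7 = 0 ∧ t 8 = 0 ∧ t 9 = 0 := by
  refine ⟨fun ⟨_, h⟩ => ⟨?_, ?_, ?_⟩, fun ⟨h0, h1, h2⟩ => ⟨skewForm_skew t, fun x y z w => ?_⟩⟩
  · have := h (basisVec 7 0) (basisVec 7 0) (basisVec 7 1) (basisVec 7 2)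
    simp [jacobian, mul_T5_7, skewForm_apply] at this
    grind
  · have := h (basisVec 7 0) (basisVec 7 0) (basisVec 7 1) (basisVec 7 3)
    simp [jacobian, mul_T5_7, skewForm_apply] at this
    grind
  · have := h (basisVec 7 0) (basisVec 7 0) (basisVec 7 2) (basisVec 7 3)
    simp [jacobian, mul_T5_7, skewForm_apply] at this
    grind
  · simp only [jacobian, mul_T5_7, skewForm_apply, h0, h1, h2, vec_coords, T5.add_apply]
    ring

lemma skewForm_mem_cocyclesTM_7 (t : Fin 10 → ℂ) :
    skewForm 7 t ∈ cocyclesTM (T5 7) ↔ t 7 = 0 ∧ t 8 = 0 ∧ t 9 = 0 ∧ t 5 = 0 ∧ t 6 = 0 := by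
  refine ⟨fun ⟨hT, h⟩ => ?_, fun h => ⟨(skewForm_mem_cocyclesT_7 t).2 ?_, fun x y z w => ?_⟩⟩
  · obtain ⟨h0, h1, h2⟩ := (skewForm_mem_cocyclesT_7 t).1 hT
    refine ⟨h0, h1, h2, ?_, ?_⟩
    · have := h (basisVec 7 0) (basisVec 7 0) (basisVec 7 1) (basisVec 7 1)
      simp [mul_T5_7, skewForm_apply] at this
      grind
    · have := h (basisVec 7 0) (basisVec 7 0) (basisVec 7 1) (basisVec 7 2)
      simp [mul_T5_7, skewForm_apply] at this
      grind
  · obtain ⟨h0, h1, h2, h3, h4⟩ := h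
    exact ⟨h0, h1, h2⟩
  · obtain ⟨h0, h1, h2, h3, h4⟩ := h
    simp only [mul_T5_7, skewForm_apply, h0, h1, h2, h3, h4, vec_coords]
    ring

lemma skewForm_mem_cocyclesT_8 (t : Fin 10 → ℂ) :
    skewForm 8 t ∈ cocyclesT (T5 8) ↔ t 7 = 0 ∧ t 8 = 0 ∧ t 9 = 0 := by
  refine ⟨fun ⟨_, h⟩ => ⟨?_, ?_, ?_⟩, fun ⟨h0, h1, h2⟩ => ⟨skewForm_skew t, fun x y z w => ?_⟩⟩
  · have := h (basisVec 8 0) (basisVec 8 0) (basisVec 8 1) (basisVec 8 2)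
    simp [jacobian, mul_T5_8, skewForm_apply] at this
    grind
  · have := h (basisVec 8 0) (basisVec 8 0) (basisVec 8 1) (basisVec 8 3)
    simp [jacobian, mul_T5_8, skewForm_apply] at this
    grind
  · have := h (basisVec 8 0) (basisVec 8 0) (basisVec 8 2) (basisVec 8 3)
    simp [jacobian, mul_T5_8, skewForm_apply] at this
    grind
  · simp only [jacobian, mul_T5_8, skewForm_apply, h0, h1, h2, vec_coords, T5.add_apply]
    ring

lemma skewForm_mem_cocyclesTM_8 (t : Fin 10 → ℂ) :
    skewForm 8 t ∈ cocyclesTM (T5 8) ↔ t 7 = 0 ∧ t 8 = 0 ∧ t 9 = 0 ∧ t 3 = t 5 ∧ t 6 = 0 := by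
  refine ⟨fun ⟨hT, h⟩ => ?_, fun h => ⟨(skewForm_mem_cocyclesT_8 t).2 ?_, fun x y z w => ?_⟩⟩
  · obtain ⟨h0, h1, h2⟩ := (skewForm_mem_cocyclesT_8 t).1 hT
    refine ⟨h0, h1, h2, ?_, ?_⟩
    · have := h (basisVec 8 0) (basisVec 8 0) (basisVec 8 1) (basisVec 8 1)
      simp [mul_T5_8, skewForm_apply] at this
      grind
    · have := h (basisVec 8 0) (basisVec 8 0) (basisVec 8 1) (basisVec 8 2)
      simp [mul_T5_8, skewForm_apply] at this
      grind
  · obtain ⟨h0, h1, h2, h3, h4⟩ := h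
    exact ⟨h0, h1, h2⟩
  · obtain ⟨h0, h1, h2, h3, h4⟩ := h
    simp only [mul_T5_8, skewForm_apply, h0, h1, h2, h3, h4, vec_coords]
    ring

lemma skewForm_mem_cocyclesT_9 (t : Fin 10 → ℂ) :
    skewForm 9 t ∈ cocyclesT (T5 9) ↔ t 3 = t 7 ∧ t 6 = 0 ∧ t 8 = 0 ∧ t 9 = 0 := by
  refine ⟨fun ⟨_, h⟩ => ⟨?_, ?_, ?_, ?_⟩, fun ⟨h0, h1, h2, h3⟩ => ⟨skewForm_skew t, fun x y z
      w => ?_⟩⟩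
  -- Since `J(e₁, e₃, e₂) = -e₅` is nonzero, `θ(e₃, e₄)` is tied to `θ(e₁, e₅)`.
  · have := h (basisVec 9 0) (basisVec 9 0) (basisVec 9 1) (basisVec 9 2)
    simp [jacobian, mul_T5_9, skewForm_apply] at this
    grind
  · have := h (basisVec 9 0) (basisVec 9 1) (basisVec 9 1) (basisVec 9 2)
    simp [jacobian, mul_T5_9, skewForm_apply] at this
    grind
  · have := h (basisVec 9 0) (basisVec 9 1) (basisVec 9 1) (basisVec 9 3)
    simp [jacobian, mul_T5_9, skewForm_apply] at this
    grind
  · have := h (basisVec 9 0) (basisVec 9 1) (basisVec 9 2) (basisVec 9 3)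
    simp [jacobian, mul_T5_9, skewForm_apply] at this
    grind
  · simp only [jacobian, mul_T5_9, skewForm_apply, h0, h1, h2, h3, vec_coords, T5.add_apply]
    ring

/-! ### Explicit bases of the cohomology spaces. -/

lemma classesFormBasis_TM_0 : ClassesFormBasis (T5 0)
    (forms 0 (pairsTM 0)) (cohomologyTM (T5 0)) := by
  refine classesFormBasis_of_coeff
    ![Delta 0 0 2, Delta 0 0 3, Delta 0 0 4, Delta 0 1 2, Delta 0 1 3, Delta 0 1 4, Delta 0 2 3,
        Delta 0 2 4, Delta 0 3 4]
    (by simp [forms, pairsTM]) (fun θ h => h.1.1) skewForm_mem_cocyclesTM_0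
    (fun g => ![0, g 0, g 1, g 2, g 3, g 4, g 5, g 6, g 7, g 8]) (fun g x y => ?_)
    (fun g => by simp) (fun g c h => ?_) fun t h => ?_
  · simp [Fin.sum_univ_succ, skewForm_apply]
    ring
  · have hk := fun k => congrFun h k
    simp [Fin.forall_fin_succ, coboundaryCoeff] at hk ⊢
    grind
  -- The coboundary of the third coordinate is `Δ₁₂` and absorbs `t 0`.
  · refine ⟨![t 1, t 2, t 3, t 4, t 5, t 6, t 7, t 8, t 9], ![0, 0, t 0, 0, 0], ?_⟩
    funext k
    fin_cases k <;> simp [coboundaryCoeff]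

lemma classesFormBasis_T_0 : ClassesFormBasis (T5 0)
    (forms 0 (pairsTM 0 ++ pairsExtra 0)) (cohomologyT (T5 0)) := by
  rw [cohomologyT_eq_cohomologyTM fun t =>
    (skewForm_mem_cocyclesT_0 t).trans (skewForm_mem_cocyclesTM_0 t).symm]
  simpa [pairsExtra] using classesFormBasis_TM_0

lemma classesFormBasis_TM_1 : ClassesFormBasis (T5 1)
    (forms 1 (pairsTM 1)) (cohomologyTM (T5 1)) := by
  refine classesFormBasis_of_coeff
    ![Delta 1 0 3, Delta 1 0 4, Delta 1 1 2, Delta 1 1 4, Delta 1 2 4]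
    (by simp [forms, pairsTM]) (fun θ h => h.1.1) skewForm_mem_cocyclesTM_1
    (fun g => ![0, 0, g 0, g 1, g 2, 0, g 3, 0, g 4, 0]) (fun g x y => ?_)
    (fun g => by simp) (fun g c h => ?_) fun t h => ?_
  · simp [Fin.sum_univ_succ, skewForm_apply]
    ring
  · have hk := fun k => congrFun h k
    simp [Fin.forall_fin_succ, coboundaryCoeff] at hk ⊢
    grind
  · refine ⟨![t 2, t 3, t 4, t 6, t 8], ![0, 0, t 0, t 1, 0], ?_⟩
    funext k
    fin_cases k <;> simp [coboundaryCoeff, h]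

lemma classesFormBasis_T_1 : ClassesFormBasis (T5 1)
    (forms 1 (pairsTM 1 ++ pairsExtra 1)) (cohomologyT (T5 1)) := by
  refine classesFormBasis_of_coeff
    ![Delta 1 0 3, Delta 1 0 4, Delta 1 1 2, Delta 1 1 4, Delta 1 2 4, Delta 1 1 3, Delta 1 3 4]
    (by simp [forms, pairsTM, pairsExtra]) (fun θ h => h.1) skewForm_mem_cocyclesT_1
    -- The additional forms `Δ₂₄`, `Δ₄₅` stand last in the list, hence `g 5` and `g 6` in their
    -- slots.
    (fun g => ![0, 0, g 0, g 1, g 2, g 5, g 3, 0, g 4, g 6]) (fun g x y => ?_)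
    (fun g => by simp) (fun g c h => ?_) fun t h => ?_
  · simp [Fin.sum_univ_succ, skewForm_apply]
    ring
  · have hk := fun k => congrFun h k
    simp [Fin.forall_fin_succ, coboundaryCoeff] at hk ⊢
    grind
  · refine ⟨![t 2, t 3, t 4, t 6, t 8, t 5, t 9], ![0, 0, t 0, t 1, 0], ?_⟩
    funext k
    fin_cases k <;> simp [coboundaryCoeff, h]

lemma classesFormBasis_TM_2 : ClassesFormBasis (T5 2)
    (forms 2 (pairsTM 2)) (cohomologyTM (T5 2)) := by
  refine classesFormBasis_of_coeff
    ![Delta 2 0 3, Delta 2 0 4, Delta 2 1 2, Delta 2 1 3, Delta 2 1 4, Delta 2 2 3, Delta 2 2 4]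
    (by simp [forms, pairsTM]) (fun θ h => h.1.1) skewForm_mem_cocyclesTM_2
    (fun g => ![0, 0, g 0, g 1, g 2, g 3, g 4, g 5, g 6, 0]) (fun g x y => ?_)
    (fun g => by simp) (fun g c h => ?_) fun t h => ?_
  · simp [Fin.sum_univ_succ, skewForm_apply]
    ring
  · have hk := fun k => congrFun h k
    simp [Fin.forall_fin_succ, coboundaryCoeff] at hk ⊢
    grind
  · refine ⟨![t 2, t 3, t 4, t 5, t 6, t 7, t 8], ![0, 0, 0, t 0, t 1], ?_⟩
    funext k
    fin_cases k <;> simp [coboundaryCoeff, h]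

lemma classesFormBasis_T_2 : ClassesFormBasis (T5 2)
    (forms 2 (pairsTM 2 ++ pairsExtra 2)) (cohomologyT (T5 2)) := by
  rw [cohomologyT_eq_cohomologyTM fun t =>
    (skewForm_mem_cocyclesT_2 t).trans (skewForm_mem_cocyclesTM_2 t).symm]
  simpa [pairsExtra] using classesFormBasis_TM_2

lemma classesFormBasis_TM_3 : ClassesFormBasis (T5 3)
    (forms 3 (pairsTM 3)) (cohomologyTM (T5 3)) := by
  refine classesFormBasis_of_coeff
    ![Delta 3 0 3, Delta 3 0 4 + Delta 3 1 3, Delta 3 1 4]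
    (by simp [forms, pairsTM]) (fun θ h => h.1.1) skewForm_mem_cocyclesTM_3
    (fun g => ![0, 0, g 0, g 1, 0, g 1, g 2, 0, 0, 0]) (fun g x y => ?_)
    (fun g => by simp) (fun g c h => ?_) fun t h => ?_
  · simp [Fin.sum_univ_succ, skewForm_apply]
    ring
  · have hk := fun k => congrFun h k
    simp [Fin.forall_fin_succ, coboundaryCoeff] at hk ⊢
    grind
  · refine ⟨![t 2, t 3, t 6], ![0, 0, t 0, t 1, t 4], ?_⟩
    funext k
    fin_cases k <;> simp [coboundaryCoeff, h]

lemma classesFormBasis_T_3 : ClassesFormBasis (T5 3)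
    (forms 3 (pairsTM 3 ++ pairsExtra 3)) (cohomologyT (T5 3)) := by
  refine classesFormBasis_of_coeff
    ![Delta 3 0 3, Delta 3 0 4 + Delta 3 1 3, Delta 3 1 4, Delta 3 0 4]
    (by simp [forms, pairsTM, pairsExtra]) (fun θ h => h.1) skewForm_mem_cocyclesT_3
    (fun g => ![0, 0, g 0, g 1 + g 3, 0, g 1, g 2, 0, 0, 0]) (fun g x y => ?_)
    (fun g => by simp) (fun g c h => ?_) fun t h => ?_
  · simp [Fin.sum_univ_succ, skewForm_apply]
    ring
  · have hk := fun k => congrFun h k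
    simp [Fin.forall_fin_succ, coboundaryCoeff] at hk ⊢
    grind
  -- `Δ₂₄` occurs only in `Δ₁₅ + Δ₂₄`, which fixes that coefficient as `t 5` and leaves `t 3 - t 5`
  -- for `Δ₁₅`.
  · refine ⟨![t 2, t 5, t 6, t 3 - t 5], ![0, 0, t 0, t 1, t 4], ?_⟩
    funext k
    fin_cases k <;> simp [coboundaryCoeff, h]

lemma classesFormBasis_TM_4 : ClassesFormBasis (T5 4)
    (forms 4 (pairsTM 4)) (cohomologyTM (T5 4)) := by
  refine classesFormBasis_of_coeff
    ![Delta 4 0 1, Delta 4 0 2, Delta 4 0 3, Delta 4 0 4, Delta 4 1 2, Delta 4 1 3, Delta 4 1 4,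
        Delta 4 2 4, Delta 4 3 4]
    (by simp [forms, pairsTM]) (fun θ h => h.1.1) skewForm_mem_cocyclesTM_4
    (fun g => ![g 0, g 1, g 2, g 3, g 4, g 5, g 6, 0, g 7, g 8]) (fun g x y => ?_)
    (fun g => by simp) (fun g c h => ?_) fun t h => ?_
  · simp [Fin.sum_univ_succ, skewForm_apply]
    ring
  · have hk := fun k => congrFun h k
    simp [Fin.forall_fin_succ, coboundaryCoeff] at hk ⊢
    grind
  -- The coboundary of the fifth coordinate is `Δ₁₂ + Δ₃₄`. It removes `Δ₃₄` at the cost of changing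
  -- the coefficient of `Δ₁₂`.
  · refine ⟨![t 0 - t 7, t 1, t 2, t 3, t 4, t 5, t 6, t 8, t 9], ![0, 0, 0, 0, t 7], ?_⟩
    funext k
    fin_cases k <;> simp [coboundaryCoeff]

lemma classesFormBasis_T_4 : ClassesFormBasis (T5 4)
    (forms 4 (pairsTM 4 ++ pairsExtra 4)) (cohomologyT (T5 4)) := by
  rw [cohomologyT_eq_cohomologyTM fun t =>
    (skewForm_mem_cocyclesT_4 t).trans (skewForm_mem_cocyclesTM_4 t).symm]
  simpa [pairsExtra] using classesFormBasis_TM_4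

lemma classesFormBasis_TM_5 : ClassesFormBasis (T5 5)
    (forms 5 (pairsTM 5)) (cohomologyTM (T5 5)) := by
  refine classesFormBasis_of_coeff
    ![Delta 5 0 2, Delta 5 0 3, Delta 5 1 3, Delta 5 1 4, Delta 5 2 3]
    (by simp [forms, pairsTM]) (fun θ h => h.1.1) skewForm_mem_cocyclesTM_5
    (fun g => ![0, g 0, g 1, 0, 0, g 2, g 3, g 4, 0, 0]) (fun g x y => ?_)
    (fun g => by simp) (fun g c h => ?_) fun t h => ?_
  · simp [Fin.sum_univ_succ, skewForm_apply]
    ring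
  · have hk := fun k => congrFun h k
    simp [Fin.forall_fin_succ, coboundaryCoeff] at hk ⊢
    grind
  -- Here the fifth coordinate has coboundary `Δ₁₄ + Δ₂₃`, used to remove `Δ₂₃`.
  · refine ⟨![t 1, t 2 - t 4, t 5, t 6, t 7], ![0, 0, t 0, 0, t 4], ?_⟩
    funext k
    fin_cases k <;> simp [coboundaryCoeff, h]

lemma classesFormBasis_T_5 : ClassesFormBasis (T5 5)
    (forms 5 (pairsTM 5 ++ pairsExtra 5)) (cohomologyT (T5 5)) := by
  refine classesFormBasis_of_coeff
    ![Delta 5 0 2, Delta 5 0 3, Delta 5 1 3, Delta 5 1 4, Delta 5 2 3, Delta 5 0 4, Delta 5 3 4]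
    (by simp [forms, pairsTM, pairsExtra]) (fun θ h => h.1) skewForm_mem_cocyclesT_5
    (fun g => ![0, g 0, g 1, g 5, 0, g 2, g 3, g 4, 0, g 6]) (fun g x y => ?_)
    (fun g => by simp) (fun g c h => ?_) fun t h => ?_
  · simp [Fin.sum_univ_succ, skewForm_apply]
    ring
  · have hk := fun k => congrFun h k
    simp [Fin.forall_fin_succ, coboundaryCoeff] at hk ⊢
    grind
  · refine ⟨![t 1, t 2 - t 4, t 5, t 6, t 7, t 3, t 9], ![0, 0, t 0, 0, t 4], ?_⟩
    funext k
    fin_cases k <;> simp [coboundaryCoeff, h]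

lemma classesFormBasis_TM_6 : ClassesFormBasis (T5 6)
    (forms 6 (pairsTM 6)) (cohomologyTM (T5 6)) := by
  refine classesFormBasis_of_coeff
    ![Delta 6 0 2, Delta 6 0 3, Delta 6 1 2, Delta 6 1 3]
    (by simp [forms, pairsTM]) (fun θ h => h.1.1) skewForm_mem_cocyclesTM_6
    (fun g => ![0, g 0, g 1, 0, g 2, g 3, 0, 0, 0, 0]) (fun g x y => ?_)
    (fun g => by simp) (fun g c h => ?_) fun t h => ?_
  · simp [Fin.sum_univ_succ, skewForm_apply]
    ring
  · have hk := fun k => congrFun h k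
    simp [Fin.forall_fin_succ, coboundaryCoeff] at hk ⊢
    grind
  · refine ⟨![t 1, t 2, t 4, t 5], ![0, 0, t 0, 0, t 7], ?_⟩
    funext k
    fin_cases k <;> simp [coboundaryCoeff, h]

lemma classesFormBasis_T_6 : ClassesFormBasis (T5 6)
    (forms 6 (pairsTM 6 ++ pairsExtra 6)) (cohomologyT (T5 6)) := by
  rw [cohomologyT_eq_cohomologyTM fun t =>
    (skewForm_mem_cocyclesT_6 t).trans (skewForm_mem_cocyclesTM_6 t).symm]
  simpa [pairsExtra] using classesFormBasis_TM_6

lemma classesFormBasis_TM_7 : ClassesFormBasis (T5 7)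
    (forms 7 (pairsTM 7)) (cohomologyTM (T5 7)) := by
  refine classesFormBasis_of_coeff
    ![Delta 7 0 4, Delta 7 1 2]
    (by simp [forms, pairsTM]) (fun θ h => h.1.1) skewForm_mem_cocyclesTM_7
    (fun g => ![0, 0, 0, g 0, g 1, 0, 0, 0, 0, 0]) (fun g x y => ?_)
    (fun g => by simp) (fun g c h => ?_) fun t h => ?_
  · simp [Fin.sum_univ_succ, skewForm_apply]
  · have hk := fun k => congrFun h k
    simp [Fin.forall_fin_succ, coboundaryCoeff] at hk ⊢
    grind
  · refine ⟨![t 3, t 4], ![0, 0, t 0, t 1, t 2], ?_⟩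
    funext k
    fin_cases k <;> simp [coboundaryCoeff, h]

lemma classesFormBasis_T_7 : ClassesFormBasis (T5 7)
    (forms 7 (pairsTM 7 ++ pairsExtra 7)) (cohomologyT (T5 7)) := by
  refine classesFormBasis_of_coeff
    ![Delta 7 0 4, Delta 7 1 2, Delta 7 1 3, Delta 7 1 4]
    (by simp [forms, pairsTM, pairsExtra]) (fun θ h => h.1) skewForm_mem_cocyclesT_7
    (fun g => ![0, 0, 0, g 0, g 1, g 2, g 3, 0, 0, 0]) (fun g x y => ?_)
    (fun g => by simp) (fun g c h => ?_) fun t h => ?_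
  · simp [Fin.sum_univ_succ, skewForm_apply]
    ring
  · have hk := fun k => congrFun h k
    simp [Fin.forall_fin_succ, coboundaryCoeff] at hk ⊢
    grind
  · refine ⟨![t 3, t 4, t 5, t 6], ![0, 0, t 0, t 1, t 2], ?_⟩
    funext k
    fin_cases k <;> simp [coboundaryCoeff, h]

lemma classesFormBasis_TM_8 : ClassesFormBasis (T5 8)
    (forms 8 (pairsTM 8)) (cohomologyTM (T5 8)) := by
  refine classesFormBasis_of_coeff
    ![Delta 8 0 3, Delta 8 0 4 + Delta 8 1 3]
    (by simp [forms, pairsTM]) (fun θ h => h.1.1) skewForm_mem_cocyclesTM_8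
    (fun g => ![0, 0, g 0, g 1, 0, g 1, 0, 0, 0, 0]) (fun g x y => ?_)
    (fun g => by simp) (fun g c h => ?_) fun t h => ?_
  · simp [Fin.sum_univ_succ, skewForm_apply]
    ring
  · have hk := fun k => congrFun h k
    simp [Fin.forall_fin_succ, coboundaryCoeff] at hk ⊢
    grind
  · refine ⟨![t 2 - t 4, t 3], ![0, 0, t 0, t 1, t 4], ?_⟩
    funext k
    fin_cases k <;> simp [coboundaryCoeff, h]

lemma classesFormBasis_T_8 : ClassesFormBasis (T5 8)
    (forms 8 (pairsTM 8 ++ pairsExtra 8)) (cohomologyT (T5 8)) := by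
  refine classesFormBasis_of_coeff
    ![Delta 8 0 3, Delta 8 0 4 + Delta 8 1 3, Delta 8 0 4, Delta 8 1 4]
    (by simp [forms, pairsTM, pairsExtra]) (fun θ h => h.1) skewForm_mem_cocyclesT_8
    (fun g => ![0, 0, g 0, g 1 + g 2, 0, g 1, g 3, 0, 0, 0]) (fun g x y => ?_)
    (fun g => by simp) (fun g c h => ?_) fun t h => ?_
  · simp [Fin.sum_univ_succ, skewForm_apply]
    ring
  · have hk := fun k => congrFun h k
    simp [Fin.forall_fin_succ, coboundaryCoeff] at hk ⊢
    grind
  · refine ⟨![t 2 - t 4, t 5, t 3 - t 5, t 6], ![0, 0, t 0, t 1, t 4], ?_⟩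
    funext k
    fin_cases k <;> simp [coboundaryCoeff, h]

lemma classesFormBasis_T_9 : ClassesFormBasis (T5 9)
    (forms 9 (pairsTM 9 ++ pairsExtra 9)) (cohomologyT (T5 9)) := by
  refine classesFormBasis_of_coeff
    ![Delta 9 0 3, Delta 9 1 2, Delta 9 2 3 + Delta 9 0 4]
    (by simp [forms, pairsTM, pairsExtra]) (fun θ h => h.1) skewForm_mem_cocyclesT_9
    (fun g => ![0, 0, g 0, g 2, g 1, 0, 0, g 2, 0, 0]) (fun g x y => ?_)
    (fun g => by simp) (fun g c h => ?_) fun t h => ?_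
  · simp [Fin.sum_univ_succ, skewForm_apply]
    ring
  · have hk := fun k => congrFun h k
    simp [Fin.forall_fin_succ, coboundaryCoeff] at hk ⊢
    grind
  · refine ⟨![t 2, t 4, t 3], ![0, 0, t 0, t 1, t 5], ?_⟩
    funext k
    fin_cases k <;> simp [coboundaryCoeff, h]

end Tortkara

namespace Tortkara

/-! ### The classification -/

section Classification

variable {A : Type*} [NonUnitalNonAssocRing A] [Module ℂ A]

variable (A) in
/-- The descending series `D 0 = A`, `D (k + 1) = A (D k)`. -/
def lowerSeries : ℕ → Submodule ℂ A
  | 0 => ⊤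
  | k + 1 => Submodule.span ℂ {z | ∃ a, ∃ x ∈ lowerSeries k, z = a * x}

lemma lowerSeries_le_power (k : ℕ) : lowerSeries A k ≤ power A (k + 1) := by
  induction k with
  | zero => rw [power, lowerSeries]
  | succ k ih =>
    rw [power, lowerSeries]
    -- The summand of index 0 is `A^1 A^(k+1)`.
    refine le_trans (Submodule.span_mono ?_) (le_iSup (fun i : Fin (k + 1) => Submodule.span ℂ
      {z | ∃ x ∈ power A (i + 1), ∃ y ∈ power A (k + 1 - i), z = x * y}) 0)
    rintro _ ⟨a, x, hx, rfl⟩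
    refine ⟨a, ?_, x, ?_, rfl⟩
    · rw [Fin.val_zero, power]
      trivial
    · simpa using ih hx

/-- Consider the first term of the descending series contained in `V`. It is not the zeroth, as `V`
is proper; an `x` outside `V` in the preceding term is multiplied into it by all of `A`. -/
lemma IsNilpotentAlgebra.exists_mul_mem (hA : IsNilpotentAlgebra A) {V : Submodule ℂ A}
    (hV : V ≠ ⊤) : ∃ x, x ∉ V ∧ ∀ a, a * x ∈ V := by
  classical
  have hex : ∃ m, lowerSeries A m ≤ V := by
    obtain ⟨n, hn, hb⟩ := hA
    obtain ⟨m, rfl⟩ := Nat.exists_eq_add_of_le' hn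
    exact ⟨m, (lowerSeries_le_power m).trans (hb ▸ bot_le)⟩
  have hmin := @Nat.find_min _ _ hex
  have hspec := Nat.find_spec hex
  cases hm : Nat.find hex with
  | zero => rw [hm, lowerSeries] at hspec; exact absurd (top_le_iff.1 hspec) hV
  | succ k =>
    obtain ⟨x, hx, hxV⟩ := SetLike.not_le_iff_exists.1 (hmin (m := k) (by omega))
    rw [hm, lowerSeries] at hspec
    exact ⟨x, hxV, fun a => hspec (Submodule.subset_span ⟨a, x, hx, rfl⟩)⟩

lemma IsNilpotentAlgebra.exists_linearIndependent_cons (hA : IsNilpotentAlgebra A) {k : ℕ}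
    (hk : k < Module.finrank ℂ A) {v : Fin k → A} (hv : LinearIndependent ℂ v) :
    ∃ x, LinearIndependent ℂ (Fin.cons x v : Fin (k + 1) → A) ∧
      ∀ a, ∃ c : Fin k → ℂ, a * x = ∑ i, c i • v i := by
  have hV : Submodule.span ℂ (Set.range v) ≠ ⊤ := fun h => by
    have := finrank_range_le_card (R := ℂ) v
    rw [Set.finrank, h, finrank_top, Fintype.card_fin] at this
    omega
  obtain ⟨x, hx, hax⟩ := hA.exists_mul_mem hV
  refine ⟨x, linearIndependent_finCons.2 ⟨hv, hx⟩, fun a => ?_⟩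
  obtain ⟨c, hc⟩ := (Submodule.mem_span_range_iff_exists_fun ℂ).1 (hax a)
  exact ⟨c, hc.symm⟩

/-- The vectors `a, b, c, d, e` are linearly independent, `e` annihilates all of them and the
remaining products are `pᵢⱼ`. -/
structure IsFrame (a b c d e p12 p13 p14 p23 p24 p34 : A) : Prop where
  li : ∀ x1 x2 x3 x4 x5 : ℂ, x1 • a + x2 • b + x3 • c + x4 • d + x5 • e = 0 →
    x1 = 0 ∧ x2 = 0 ∧ x3 = 0 ∧ x4 = 0 ∧ x5 = 0
  h12 : a * b = p12
  h13 : a * c = p13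
  h14 : a * d = p14
  h15 : a * e = 0
  h23 : b * c = p23
  h24 : b * d = p24
  h25 : b * e = 0
  h34 : c * d = p34
  h35 : c * e = 0
  h45 : d * e = 0

variable (A) in
/-- Anticommutativity, together with `dim A = 5`. -/
structure IsAnticommutativeFive : Prop where
  anticomm : ∀ x y : A, x * y = -(y * x)
  finrank_eq : Module.finrank ℂ A = 5

/-- Each new vector is prepended and is multiplied by `A` into the span of those already chosen;
this gives the triangular shape of the products. -/
lemma IsNilpotentAlgebra.exists_isFrame (hA : IsNilpotentAlgebra A)
    (hdim : Module.finrank ℂ A = 5) : ∃ (a b c d e : A) (α₃ α₄ α₅ β₄ β₅ γ₄ γ₅ δ ε ζ : ℂ),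
      IsFrame a b c d e (α₃ • c + α₄ • d + α₅ • e) (β₄ • d + β₅ • e) (δ • e) (γ₄ • d + γ₅ • e)
        (ε • e) (ζ • e) := by
  obtain ⟨e, he, hxe⟩ := hA.exists_linearIndependent_cons (by omega)
    (linearIndependent_empty_type (v := (![] : Fin 0 → A)))
  obtain ⟨d, hd, hxd⟩ := hA.exists_linearIndependent_cons (by omega) he
  obtain ⟨c, hc, hxc⟩ := hA.exists_linearIndependent_cons (by omega) hd
  obtain ⟨b, hb, hxb⟩ := hA.exists_linearIndependent_cons (by omega) hc
  obtain ⟨a, ha, -⟩ := hA.exists_linearIndependent_cons (by omega) hb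
  simp only [Fin.sum_univ_succ, Fin.cons_zero, Fin.cons_succ, Finset.univ_eq_empty,
    Finset.sum_empty, add_zero] at hxe hxd hxc hxb
  obtain ⟨u, hu⟩ := hxb a
  obtain ⟨v, hv⟩ := hxc a
  obtain ⟨w, hw⟩ := hxc b
  obtain ⟨p, hp⟩ := hxd a
  obtain ⟨q, hq⟩ := hxd b
  obtain ⟨r, hr⟩ := hxd c
  refine ⟨a, b, c, d, e, _, _, _, _, _, _, _, _, _, _, ?_, hu.trans (add_assoc _ _ _).symm, hv, hp,
    (hxe a).elim fun _ h => h, hw, hq, (hxe b).elim fun _ h => h, hr, (hxe c).elim fun _ h => h,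
    (hxe d).elim fun _ h => h⟩
  intro x1 x2 x3 x4 x5 hx
  have := Fintype.linearIndependent_iff.1 ha ![x1, x2, x3, x4, x5] (by
    simp [Fin.sum_univ_succ, ← hx, add_assoc])
  exact ⟨this 0, this 1, this 2, this 3, this 4⟩

section Frame

variable {a b c d e p12 p13 p14 p23 p24 p34 : A}

lemma IsFrame.linearIndependent (F : IsFrame a b c d e p12 p13 p14 p23 p24 p34) :
    LinearIndependent ℂ ![a, b, c, d, e] := by
  rw [Fintype.linearIndependent_iff]
  intro g hg
  obtain ⟨h0, h1, h2, h3, h4⟩ := F.li (g 0) (g 1) (g 2) (g 3) (g 4) (by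
    simpa [Fin.sum_univ_five] using hg)
  intro i
  fin_cases i <;> assumption

/-- The complete multiplication table of a frame. -/
lemma IsFrame.products (F : IsFrame a b c d e p12 p13 p14 p23 p24 p34)
    (hA : IsAnticommutativeFive A) :
    (a * a = 0 ∧ a * b = p12 ∧ a * c = p13 ∧ a * d = p14 ∧ a * e = 0) ∧
    (b * a = -p12 ∧ b * b = 0 ∧ b * c = p23 ∧ b * d = p24 ∧ b * e = 0) ∧
    (c * a = -p13 ∧ c * b = -p23 ∧ c * c = 0 ∧ c * d = p34 ∧ c * e = 0) ∧
    (d * a = -p14 ∧ d * b = -p24 ∧ d * c = -p34 ∧ d * d = 0 ∧ d * e = 0) ∧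
    (e * a = 0 ∧ e * b = 0 ∧ e * c = 0 ∧ e * d = 0 ∧ e * e = 0) := by
  obtain ⟨-, h12, h13, h14, h15, h23, h24, h25, h34, h35, h45⟩ := F
  -- Anticommutativity gives `2x² = 0`.
  have sq : ∀ x : A, x * x = 0 := fun x => by
    have h : (2 : ℂ) • (x * x) = 0 := by
      rw [two_smul]
      exact eq_neg_iff_add_eq_zero.1 (hA.anticomm x x)
    exact (smul_eq_zero.1 h).resolve_left two_ne_zero
  refine ⟨⟨sq a, h12, h13, h14, h15⟩, ⟨?_, sq b, h23, h24, h25⟩, ⟨?_, ?_, sq c, h34, h35⟩,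
    ⟨?_, ?_, ?_, sq d, h45⟩, ?_, ?_, ?_, ?_, sq e⟩ <;>
    rw [hA.anticomm] <;> simp [h12, h13, h14, h15, h23, h24, h25, h34, h35, h45]

/-- Together with `IsFrame.swap23` and `IsFrame.swap34` this generates all permutations of the first
four vectors, used to move a nonzero product to the place of `ab`. -/
lemma IsFrame.swap12 (F : IsFrame a b c d e p12 p13 p14 p23 p24 p34)
    (hA : IsAnticommutativeFive A) : IsFrame b a c d e (-p12) p23 p24 p13 p14 p34 := by
  have P := F.products hA
  constructor
  · intro x1 x2 x3 x4 x5 hx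
    have := F.li x2 x1 x3 x4 x5 (by rw [← hx]; module)
    tauto
  all_goals simp [P]

lemma IsFrame.swap23 (F : IsFrame a b c d e p12 p13 p14 p23 p24 p34)
    (hA : IsAnticommutativeFive A) : IsFrame a c b d e p13 p12 p14 (-p23) p34 p24 := by
  have P := F.products hA
  constructor
  · intro x1 x2 x3 x4 x5 hx
    have := F.li x1 x3 x2 x4 x5 (by rw [← hx]; module)
    tauto
  all_goals simp [P]

lemma IsFrame.swap34 (F : IsFrame a b c d e p12 p13 p14 p23 p24 p34)
    (hA : IsAnticommutativeFive A) : IsFrame a b d c e p12 p14 p13 p24 p23 (-p34) := by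
  have P := F.products hA
  constructor
  · intro x1 x2 x3 x4 x5 hx
    have := F.li x1 x2 x4 x3 x5 (by rw [← hx]; module)
    tauto
  all_goals simp [P]

variable [IsScalarTower ℂ A A] [SMulCommClass ℂ A A]

/-- Five independent vectors form a basis in dimension 5, and the linear map matching the bases is
multiplicative once the tables agree. -/
lemma IsFrame.isIsomorphic (F : IsFrame a b c d e p12 p13 p14 p23 p24 p34)
    (hA : IsAnticommutativeFive A) {n : Fin 10}
    (h : ∀ x y : T5 n, (x * y) 0 • a + (x * y) 1 • b + (x * y) 2 • c + (x * y) 3 • d + (x * y)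
        4 • e =
      (x 0 * y 1 - x 1 * y 0) • p12 + (x 0 * y 2 - x 2 * y 0) • p13 +
      (x 0 * y 3 - x 3 * y 0) • p14 + (x 1 * y 2 - x 2 * y 1) • p23 +
      (x 1 * y 3 - x 3 * y 1) • p24 + (x 2 * y 3 - x 3 * y 2) • p34) :
    IsIsomorphic A (T5 n) := by
  let φ : T5 n ≃ₗ[ℂ] A := (T5.coordEquiv n).trans
    (basisOfLinearIndependentOfCardEqFinrank F.linearIndependent (by simp
        [hA.finrank_eq])).equivFun.symm
  have hφ : ∀ x, φ x = x 0 • a + x 1 • b + x 2 • c + x 3 • d + x 4 • e := fun x => by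
    simp [φ, Module.Basis.equivFun_symm_apply, Fin.sum_univ_five]
    rfl
  refine IsIsomorphic.symm ⟨φ, fun x y => ?_⟩
  rw [hφ, hφ, hφ, h]
  simp only [mul_add, add_mul, smul_mul_assoc, mul_smul_comm, F.products hA]
  module

lemma IsFrame.isIsomorphic_T5_0 (F : IsFrame a b c d e c 0 0 0 0 0)
    (hA : IsAnticommutativeFive A) : IsIsomorphic A (T5 0) :=
  F.isIsomorphic hA fun x y => by
    simp only [mul_T5_0, vec_coords]
    module

lemma IsFrame.isIsomorphic_T5_1 (F : IsFrame a b c d e c d 0 0 0 0)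
    (hA : IsAnticommutativeFive A) : IsIsomorphic A (T5 1) :=
  F.isIsomorphic hA fun x y => by
    simp only [mul_T5_1, vec_coords]
    module

lemma IsFrame.isIsomorphic_T5_2 (F : IsFrame a b c d e d e 0 0 0 0)
    (hA : IsAnticommutativeFive A) : IsIsomorphic A (T5 2) :=
  F.isIsomorphic hA fun x y => by
    simp only [mul_T5_2, vec_coords]
    module

lemma IsFrame.isIsomorphic_T5_3 (F : IsFrame a b c d e c d 0 e 0 0)
    (hA : IsAnticommutativeFive A) : IsIsomorphic A (T5 3) :=
  F.isIsomorphic hA fun x y => by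
    simp only [mul_T5_3, vec_coords]
    module

lemma IsFrame.isIsomorphic_T5_4 (F : IsFrame a b c d e e 0 0 0 0 e)
    (hA : IsAnticommutativeFive A) : IsIsomorphic A (T5 4) :=
  F.isIsomorphic hA fun x y => by
    simp only [mul_T5_4, vec_coords]
    module

lemma IsFrame.isIsomorphic_T5_5 (F : IsFrame a b c d e c 0 e e 0 0)
    (hA : IsAnticommutativeFive A) : IsIsomorphic A (T5 5) :=
  F.isIsomorphic hA fun x y => by
    simp only [mul_T5_5, vec_coords]
    module

lemma IsFrame.isIsomorphic_T5_6 (F : IsFrame a b c d e c 0 0 0 0 e)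
    (hA : IsAnticommutativeFive A) : IsIsomorphic A (T5 6) :=
  F.isIsomorphic hA fun x y => by
    simp only [mul_T5_6, vec_coords]
    module

lemma IsFrame.isIsomorphic_T5_7 (F : IsFrame a b c d e c d e 0 0 0)
    (hA : IsAnticommutativeFive A) : IsIsomorphic A (T5 7) :=
  F.isIsomorphic hA fun x y => by
    simp only [mul_T5_7, vec_coords]
    module

lemma IsFrame.isIsomorphic_T5_8 (F : IsFrame a b c d e c d e e 0 0)
    (hA : IsAnticommutativeFive A) : IsIsomorphic A (T5 8) :=
  F.isIsomorphic hA fun x y => by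
    simp only [mul_T5_8, vec_coords]
    module

lemma IsFrame.isIsomorphic_T5_9 (F : IsFrame a b c d e c d 0 0 e 0)
    (hA : IsAnticommutativeFive A) : IsIsomorphic A (T5 9) :=
  F.isIsomorphic hA fun x y => by
    simp only [mul_T5_9, vec_coords]
    module

end Frame

end Classification

end Tortkara

namespace Tortkara

/-! ### Reduction of multiplication tables to normal forms. -/

section Classification

set_option linter.unusedSimpArgs false
set_option linter.unnecessarySeqFocus false
set_option linter.unreachableTactic false
set_option linter.unusedTactic false

variable {A : Type*} [NonUnitalNonAssocRing A] [Module ℂ A] [IsScalarTower ℂ A A]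
  [SMulCommClass ℂ A A] {a b c d e : A}

/-- Algebras with one-dimensional square in which `ab ≠ 0`. -/
lemma IsFrame.exists_isIsomorphic_of_ne_zero {p q r s u w : ℂ}
    (F : IsFrame a b c d e (p • e) (q • e) (r • e) (s • e) (u • e) (w • e))
    (hA : IsAnticommutativeFive A) (hp : p ≠ 0) :
    ∃ n, IsIsomorphic A (T5 n) := by
  have P := F.products hA
  -- Multiples of `a` and `b` are added to `c` and `d` so that both products with `a` and `b`
  -- vanish. The corrected vectors have product `k • e`, and `p * k` is the Pfaffian of the skew
  -- form.
  obtain ⟨k, hk⟩ : ∃ k, k = w + (r * s - u * q) / p := ⟨_, rfl⟩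
  by_cases hk0 : k = 0
  · subst hk0
    have G : IsFrame a b (p • e) (c + (s / p) • a - (q / p) • b) (d + (u / p) • a - (r / p) • b)
        (p • e) 0 0 0 0 0 := by
      constructor
      · intro x1 x2 x3 x4 x5 hx
        have := F.li (x1 + x4 * (s / p) + x5 * (u / p)) (x2 - x4 * (q / p) - x5 * (r / p)) x4 x5
            (x3 * p) (by rw [← hx]; module)
        grind
      all_goals simp only [mul_add, add_mul, mul_sub, sub_mul, smul_mul_assoc, mul_smul_comm, P] <;>
        match_scalars <;> grind
    exact ⟨0, G.isIsomorphic_T5_0 hA⟩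
  -- The factor `p / k` makes the third and fourth vectors multiply to `p • e`, like `a` and `b`.
  · have G : IsFrame a b (c + (s / p) • a - (q / p) • b) ((p / k) • (d + (u / p) • a - (r / p)
        • b)) (p • e)
        (p • e) 0 0 0 0 (p • e) := by
      constructor
      · intro x1 x2 x3 x4 x5 hx
        have := F.li (x1 + x3 * (s / p) + x4 * (p / k) * (u / p)) (x2 - x3 * (q / p) - x4 * (p / k)
            * (r / p)) x3 (x4 * (p / k)) (x5 * p) (by rw [← hx]; module)
        grind
      all_goals simp only [mul_add, add_mul, mul_sub, sub_mul, smul_mul_assoc, mul_smul_comm, P] <;>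
        match_scalars <;> grind
    exact ⟨4, G.isIsomorphic_T5_4 hA⟩

/-- Algebras with one-dimensional square. -/
lemma IsFrame.exists_isIsomorphic_of_multiples {p q r s u w : ℂ}
    (F : IsFrame a b c d e (p • e) (q • e) (r • e) (s • e) (u • e) (w • e))
    (hA : IsAnticommutativeFive A) (h : ¬(p = 0 ∧ q = 0 ∧ r = 0 ∧ s = 0 ∧ u = 0 ∧ w = 0)) :
    ∃ n, IsIsomorphic A (T5 n) := by
  by_cases hp : p ≠ 0
  · exact F.exists_isIsomorphic_of_ne_zero hA hp
  by_cases hq : q ≠ 0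
  · have G := F.swap23 hA
    simp only [← neg_smul] at G
    exact G.exists_isIsomorphic_of_ne_zero hA hq
  by_cases hr : r ≠ 0
  · have G := (F.swap34 hA).swap23 hA
    simp only [← neg_smul] at G
    exact G.exists_isIsomorphic_of_ne_zero hA hr
  by_cases hs : s ≠ 0
  · have G := (F.swap12 hA).swap23 hA
    simp only [← neg_smul] at G
    exact G.exists_isIsomorphic_of_ne_zero hA hs
  by_cases hu : u ≠ 0
  · have G := ((F.swap12 hA).swap34 hA).swap23 hA
    simp only [← neg_smul] at G
    exact G.exists_isIsomorphic_of_ne_zero hA hu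
  -- The order is now `c, d, a, b`.
  have G := (((F.swap23 hA).swap12 hA).swap34 hA).swap23 hA
  simp only [← neg_smul] at G
  exact G.exists_isIsomorphic_of_ne_zero hA (by tauto)

/-- Algebras with `ab = c`, `cd = 0 ≠ bc` in which the other products are multiples of `e`. -/
lemma IsFrame.exists_isIsomorphic_of_cube_multiples_of_ne_zero {β γ δ ε : ℂ}
    (F : IsFrame a b c d e c (β • e) (δ • e) (γ • e) (ε • e) 0)
    (hA : IsAnticommutativeFive A) (hγ : γ ≠ 0) :
    ∃ n, IsIsomorphic A (T5 n) := by
  have P := F.products hA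
  -- As `bc = γ • e` with `γ ≠ 0`, subtracting `(β / γ) • b` from `a` kills `ac`, and subtracting
  -- `(ε / γ) • c` from `d` kills `bd`. Then `ad` becomes `k • e`.
  obtain ⟨k, hk⟩ : ∃ k, k = δ - β * ε / γ := ⟨_, rfl⟩
  by_cases hk0 : k = 0
  · subst hk0
    have G : IsFrame b ((-1 : ℂ) • (a - (β / γ) • b)) c (γ • e) (d - (ε / γ) • c) c (γ • e) 0 0 0
        0 := by
      constructor
      · intro x1 x2 x3 x4 x5 hx
        have := F.li (-x2) (x1 + x2 * (β / γ)) (x3 - x5 * (ε / γ)) x5 (x4 * γ)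
          (by rw [← hx]; module)
        grind
      all_goals simp only [mul_add, add_mul, mul_sub, sub_mul, smul_mul_assoc, mul_smul_comm, P] <;>
        match_scalars <;> grind
    exact ⟨1, G.isIsomorphic_T5_1 hA⟩
  · have G : IsFrame (a - (β / γ) • b) b c ((γ / k) • (d - (ε / γ) • c)) (γ • e) c 0 (γ • e)
        (γ • e) 0 0 := by
      constructor
      · intro x1 x2 x3 x4 x5 hx
        have := F.li x1 (x2 - x1 * (β / γ)) (x3 - x4 * (γ / k) * (ε / γ)) (x4 * (γ / k)) (x5 * γ)
          (by rw [← hx]; module)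
        grind
      all_goals simp only [mul_add, add_mul, mul_sub, sub_mul, smul_mul_assoc, mul_smul_comm, P] <;>
        match_scalars <;> grind
    exact ⟨5, G.isIsomorphic_T5_5 hA⟩

/-- Algebras with `ab = c` in which the other products are multiples of `e`. -/
lemma IsFrame.exists_isIsomorphic_of_cube_multiples {β γ δ ε ζ : ℂ}
    (F : IsFrame a b c d e c (β • e) (δ • e) (γ • e) (ε • e) (ζ • e))
    (hA : IsAnticommutativeFive A) : ∃ n, IsIsomorphic A (T5 n) := by
  have P := F.products hA
  by_cases hζ : ζ ≠ 0
  -- As `cd = ζ • e` with `ζ ≠ 0`, adding multiples of `c` and `d` makes `a` and `b` annihilate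
  -- both. Their product changes only by a multiple of `e`, which is absorbed in the new `c`.
  · have G : IsFrame (a + (β / ζ) • d - (δ / ζ) • c) (b + (γ / ζ) • d - (ε / ζ) • c)
        (c + ((γ * δ - β * ε) / ζ) • e) d (ζ • e)
        (c + ((γ * δ - β * ε) / ζ) • e) 0 0 0 0 (ζ • e) := by
      constructor
      · intro x1 x2 x3 x4 x5 hx
        have := F.li x1 x2 (x3 - x1 * (δ / ζ) - x2 * (ε / ζ)) (x4 + x1 * (β / ζ) + x2 * (γ / ζ))
            (x3 * ((γ * δ - β * ε) / ζ) + x5 * ζ) (by rw [← hx]; module)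
        grind
      all_goals simp only [mul_add, add_mul, mul_sub, sub_mul, smul_mul_assoc, mul_smul_comm, P] <;>
        match_scalars <;> grind
    exact ⟨6, G.isIsomorphic_T5_6 hA⟩
  obtain rfl : ζ = 0 := not_not.1 hζ
  rw [zero_smul] at F P
  by_cases hγ : γ ≠ 0
  · exact F.exists_isIsomorphic_of_cube_multiples_of_ne_zero hA hγ
  by_cases hβ : β ≠ 0
  -- Replacing `a, b` by `b, -a` preserves `ab = c` and exchanges the roles of `ac` and `bc`.
  · have G : IsFrame b ((-1 : ℂ) • a) c d e
        c (γ • e) (ε • e) ((-β) • e) ((-δ) • e) 0 := by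
      constructor
      · intro x1 x2 x3 x4 x5 hx
        have := F.li (-x2) x1 x3 x4 x5 (by rw [← hx]; module)
        grind
      all_goals simp only [mul_add, add_mul, mul_sub, sub_mul, smul_mul_assoc, mul_smul_comm, P] <;>
        match_scalars <;> grind
    exact G.exists_isIsomorphic_of_cube_multiples_of_ne_zero hA (neg_ne_zero.2 hβ)
  obtain rfl : γ = 0 := not_not.1 hγ
  obtain rfl : β = 0 := not_not.1 hβ
  by_cases hδ : δ ≠ 0
  · have G : IsFrame a (b - (ε / δ) • a) d c (δ • e) c (δ • e) 0 0 0 0 := by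
      constructor
      · intro x1 x2 x3 x4 x5 hx
        have := F.li (x1 - x2 * (ε / δ)) x2 x4 x3 (x5 * δ) (by rw [← hx]; module)
        grind
      all_goals simp only [mul_add, add_mul, mul_sub, sub_mul, smul_mul_assoc, mul_smul_comm, P] <;>
        match_scalars <;> grind
    exact ⟨2, G.isIsomorphic_T5_2 hA⟩
  by_cases hε : ε ≠ 0
  · have G : IsFrame b ((-1 : ℂ) • a) d c (ε • e) c (ε • e) 0 0 0 0 := by
      constructor
      · intro x1 x2 x3 x4 x5 hx
        have := F.li (-x2) x1 x4 x3 (x5 * ε) (by rw [← hx]; module)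
        grind
      all_goals simp only [mul_add, add_mul, mul_sub, sub_mul, smul_mul_assoc, mul_smul_comm, P] <;>
        match_scalars <;> grind
    exact ⟨2, G.isIsomorphic_T5_2 hA⟩
  obtain rfl : δ = 0 := not_not.1 hδ
  obtain rfl : ε = 0 := not_not.1 hε
  rw [zero_smul] at F
  exact ⟨0, F.isIsomorphic_T5_0 hA⟩

/-- Tortkara algebras with `ab = c`, `ac = d` in which the other products are multiples of `e`. -/
lemma IsFrame.exists_isIsomorphic_of_generated {γ δ ε ζ : ℂ}
    (F : IsFrame a b c d e c d (δ • e) (γ • e) (ε • e) (ζ • e))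
    (hA : IsAnticommutativeFive A)
    (hT : ∀ x y z : A, (x * y) * (z * y) = jacobian x y z * y) :
    ∃ n, IsIsomorphic A (T5 n) := by
  have P := F.products hA
  -- The left side is `(ba)(ca) = cd = ζ • e`. On the right, `J(b, a, c)` is a multiple of `e`, so
  -- its product with `a` vanishes.
  have hζ : ζ = 0 := by
    have h := hT b a c
    simp only [jacobian, add_mul, neg_mul, mul_neg, smul_mul_assoc, P] at h
    exact (F.li 0 0 0 0 ζ (by simpa using h)).2.2.2.2
  subst hζ
  rw [zero_smul] at F P
  by_cases hε : ε ≠ 0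
  -- With `bd = ε • e ≠ 0`, changing `a` by a multiple of `b` kills `ad`, and changing `b` by a
  -- multiple of `c` kills `bc`. The third and fourth vectors are the resulting products `ab` and
  -- `ac`.
  · have G : IsFrame (a - (δ / ε) • b) (b - (γ / ε) • c) (c - (γ / ε) • (d - (δ * γ / ε) • e)) (d -
        (δ * γ / ε) • e) (ε • e)
        (c - (γ / ε) • (d - (δ * γ / ε) • e)) (d - (δ * γ / ε) • e) 0 0 (ε • e) 0 := by
      constructor
      · intro x1 x2 x3 x4 x5 hx
        have := F.li x1 (x2 - x1 * (δ / ε)) (x3 - x2 * (γ / ε)) (x4 - x3 * (γ / ε)) (x3 * (γ / ε) *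
            (δ * γ / ε) - x4 * (δ * γ / ε) + x5 * ε) (by rw [← hx]; module)
        grind
      all_goals simp only [mul_add, add_mul, mul_sub, sub_mul, smul_mul_assoc, mul_smul_comm, P] <;>
        match_scalars <;> grind
    exact ⟨9, G.isIsomorphic_T5_9 hA⟩
  obtain rfl : ε = 0 := not_not.1 hε
  rw [zero_smul] at F P
  by_cases hδ : δ = 0
  · subst hδ
    rw [zero_smul] at F P
    by_cases hγ : γ = 0
    · subst hγ
      rw [zero_smul] at F
      exact ⟨1, F.isIsomorphic_T5_1 hA⟩
    · have G : IsFrame a b c d (γ • e) c d 0 (γ • e) 0 0 := by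
        constructor
        · intro x1 x2 x3 x4 x5 hx
          have := F.li x1 x2 x3 x4 (x5 * γ) (by rw [← hx]; module)
          grind
        all_goals simp only [mul_add, add_mul, mul_sub, sub_mul, smul_mul_assoc, mul_smul_comm, P]
            <;>
          match_scalars <;> grind
      exact ⟨3, G.isIsomorphic_T5_3 hA⟩
  · by_cases hγ : γ = 0
    · subst hγ
      rw [zero_smul] at F P
      have G : IsFrame a b c d (δ • e) c d (δ • e) 0 0 0 := by
        constructor
        · intro x1 x2 x3 x4 x5 hx
          have := F.li x1 x2 x3 x4 (x5 * δ) (by rw [← hx]; module)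
          grind
        all_goals simp only [mul_add, add_mul, mul_sub, sub_mul, smul_mul_assoc, mul_smul_comm, P]
            <;>
          match_scalars <;> grind
      exact ⟨7, G.isIsomorphic_T5_7 hA⟩
    -- Scaling `b, c, d` by `t` multiplies `ad` by `t` and `bc` by `t²`; the two agree for `t = δ /
    -- γ`.
    · have G : IsFrame a ((δ / γ) • b) ((δ / γ) • c) ((δ / γ) • d) (((δ / γ) * δ) • e)
          ((δ / γ) • c) ((δ / γ) • d) (((δ / γ) * δ) • e) (((δ / γ) * δ) • e) 0 0 := by
        constructor
        · intro x1 x2 x3 x4 x5 hx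
          have := F.li x1 (x2 * (δ / γ)) (x3 * (δ / γ)) (x4 * (δ / γ)) (x5 * ((δ / γ) * δ))
            (by rw [← hx]; module)
          grind
        all_goals simp only [mul_add, add_mul, mul_sub, sub_mul, smul_mul_assoc, mul_smul_comm, P]
            <;>
          match_scalars <;> grind
      exact ⟨8, G.isIsomorphic_T5_8 hA⟩

/-- Tortkara algebras with `ab = c` in which `ac` is not a multiple of `e`. -/
lemma IsFrame.exists_isIsomorphic_of_mul_mul_ne_zero {β₄ β₅ γ₄ γ₅ δ ε ζ : ℂ}
    (F : IsFrame a b c d e c (β₄ • d + β₅ • e) (δ • e) (γ₄ • d + γ₅ • e) (ε • e) (ζ • e))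
    (hA : IsAnticommutativeFive A)
    (hT : ∀ x y z : A, (x * y) * (z * y) = jacobian x y z * y) (hβ : β₄ ≠ 0) :
    ∃ n, IsIsomorphic A (T5 n) := by
  have P := F.products hA
  -- The new `d` is `ac`, and the change of `b` makes `bc` a multiple of `e`.
  have G : IsFrame a (b - (γ₄ / β₄) • a) c (β₄ • d + β₅ • e) e
      c (β₄ • d + β₅ • e) ((β₄ * δ) • e) ((γ₅ - (γ₄ / β₄) * β₅) • e) ((β₄ * (ε - (γ₄ / β₄) * δ))
          • e) ((β₄ * ζ) • e) := by
    constructor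
    · intro x1 x2 x3 x4 x5 hx
      have := F.li (x1 - x2 * (γ₄ / β₄)) x2 x3 (x4 * β₄) (x4 * β₅ + x5) (by rw [← hx]; module)
      grind
    all_goals simp only [mul_add, add_mul, mul_sub, sub_mul, smul_mul_assoc, mul_smul_comm, P] <;>
      match_scalars <;> grind
  exact G.exists_isIsomorphic_of_generated hA hT

/-- Tortkara algebras with `ab = c`. -/
lemma IsFrame.exists_isIsomorphic_of_mul_eq {β₄ β₅ γ₄ γ₅ δ ε ζ : ℂ}
    (F : IsFrame a b c d e c (β₄ • d + β₅ • e) (δ • e) (γ₄ • d + γ₅ • e) (ε • e) (ζ • e))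
    (hA : IsAnticommutativeFive A)
    (hT : ∀ x y z : A, (x * y) * (z * y) = jacobian x y z * y) :
    ∃ n, IsIsomorphic A (T5 n) := by
  have P := F.products hA
  by_cases hβ : β₄ ≠ 0
  · exact F.exists_isIsomorphic_of_mul_mul_ne_zero hA hT hβ
  by_cases hγ : γ₄ ≠ 0
  · have G : IsFrame b ((-1 : ℂ) • a) c d e
        c (γ₄ • d + γ₅ • e) (ε • e) ((-β₄) • d + (-β₅) • e) ((-δ) • e) (ζ • e) := by
      constructor
      · intro x1 x2 x3 x4 x5 hx
        have := F.li (-x2) x1 x3 x4 x5 (by rw [← hx]; module)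
        grind
      all_goals simp only [mul_add, add_mul, mul_sub, sub_mul, smul_mul_assoc, mul_smul_comm, P] <;>
        match_scalars <;> grind
    exact G.exists_isIsomorphic_of_mul_mul_ne_zero hA hT hγ
  rw [not_not.1 hβ, not_not.1 hγ, zero_smul, zero_add, zero_add] at F
  exact F.exists_isIsomorphic_of_cube_multiples hA

/-- Algebras whose square lies in the span of `d` and `e`, where `ab` is not a multiple of `e`. -/
lemma IsFrame.exists_isIsomorphic_of_three_generators_aux {α₄ α₅ β₄ β₅ γ₄ γ₅ δ ε ζ : ℂ}
    (F : IsFrame a b c d e (α₄ • d + α₅ • e) (β₄ • d + β₅ • e) (δ • e) (γ₄ • d + γ₅ • e) (ε • e)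
        (ζ • e))
    (hA : IsAnticommutativeFive A) (hα : α₄ ≠ 0) :
    ∃ n, IsIsomorphic A (T5 n) := by
  have P := F.products hA
  -- The product `ab` replaces `d` and moves to third place. The old `c` is corrected so that its
  -- products with `a` and `b` are multiples of `e`.
  have G : IsFrame a b (α₄ • d + α₅ • e) (c + (γ₄ / α₄) • a - (β₄ / α₄) • b) e
      (α₄ • d + α₅ • e) ((α₄ * δ) • e) ((β₅ - (β₄ / α₄) * α₅) • e) ((α₄ * ε) • e) ((γ₅ - (γ₄ / α₄)
          * α₅) • e) ((-(α₄ * (ζ + (γ₄ / α₄) * δ - (β₄ / α₄) * ε))) • e) := by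
    constructor
    · intro x1 x2 x3 x4 x5 hx
      have := F.li (x1 + x4 * (γ₄ / α₄)) (x2 - x4 * (β₄ / α₄)) x4 (x3 * α₄) (x3 * α₅ + x5)
        (by rw [← hx]; module)
      grind
    all_goals simp only [mul_add, add_mul, mul_sub, sub_mul, smul_mul_assoc, mul_smul_comm, P] <;>
      match_scalars <;> grind
  exact G.exists_isIsomorphic_of_cube_multiples hA

lemma IsFrame.not_isNontrivialAlgebra (F : IsFrame a b c d e 0 0 0 0 0 0)
    (hA : IsAnticommutativeFive A) : ¬IsNontrivialAlgebra A := by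
  rintro ⟨x, y, hxy⟩
  have P := F.products hA
  have hgen : ∀ x : A, ∃ x1 x2 x3 x4 x5 : ℂ, x = x1 • a + x2 • b + x3 • c + x4 • d + x5 • e := by
    have hspan := F.linearIndependent.span_eq_top_of_card_eq_finrank (by simp [hA.finrank_eq])
    intro x
    obtain ⟨g, hg⟩ := (Submodule.mem_span_range_iff_exists_fun ℂ).1
      (hspan ▸ Submodule.mem_top (x := x))
    exact ⟨g 0, g 1, g 2, g 3, g 4, by simp [← hg, Fin.sum_univ_five]⟩
  obtain ⟨x1, x2, x3, x4, x5, rfl⟩ := hgen x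
  obtain ⟨y1, y2, y3, y4, y5, rfl⟩ := hgen y
  simp [mul_add, add_mul, smul_mul_assoc, mul_smul_comm, P] at hxy

/-- Algebras whose square lies in the span of `d` and `e`. -/
lemma IsFrame.exists_isIsomorphic_of_three_generators {α₄ α₅ β₄ β₅ γ₄ γ₅ δ ε ζ : ℂ}
    (F : IsFrame a b c d e (α₄ • d + α₅ • e) (β₄ • d + β₅ • e) (δ • e) (γ₄ • d + γ₅ • e) (ε • e)
        (ζ • e))
    (hA : IsAnticommutativeFive A) (h : IsNontrivialAlgebra A) :
    ∃ n, IsIsomorphic A (T5 n) := by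
  by_cases hα : α₄ ≠ 0
  · exact F.exists_isIsomorphic_of_three_generators_aux hA hα
  by_cases hβ : β₄ ≠ 0
  · have G := F.swap23 hA
    simp only [neg_add, ← neg_smul] at G
    exact G.exists_isIsomorphic_of_three_generators_aux hA hβ
  by_cases hγ : γ₄ ≠ 0
  · have G := (F.swap12 hA).swap23 hA
    simp only [neg_add, ← neg_smul] at G
    exact G.exists_isIsomorphic_of_three_generators_aux hA hγ
  rw [not_not.1 hα, not_not.1 hβ, not_not.1 hγ, zero_smul, zero_add, zero_add, zero_add] at F
  refine F.exists_isIsomorphic_of_multiples hA ?_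
  rintro ⟨rfl, rfl, rfl, rfl, rfl, rfl⟩
  simp only [zero_smul] at F
  exact F.not_isNontrivialAlgebra hA h

/-- Every algebra with a frame adapted to a flag of ideals is one of the ten. -/
lemma IsFrame.exists_isIsomorphic {α₃ α₄ α₅ β₄ β₅ γ₄ γ₅ δ ε ζ : ℂ}
    (F : IsFrame a b c d e (α₃ • c + α₄ • d + α₅ • e) (β₄ • d + β₅ • e) (δ • e)
      (γ₄ • d + γ₅ • e) (ε • e) (ζ • e))
    (hA : IsAnticommutativeFive A)
    (hT : ∀ x y z : A, (x * y) * (z * y) = jacobian x y z * y)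
    (h : IsNontrivialAlgebra A) :
    ∃ n, IsIsomorphic A (T5 n) := by
  have P := F.products hA
  by_cases hα : α₃ = 0
  · rw [hα, zero_smul, zero_add] at F
    exact F.exists_isIsomorphic_of_three_generators hA h
  · have G : IsFrame a b (α₃ • c + α₄ • d + α₅ • e) d e
        (α₃ • c + α₄ • d + α₅ • e) ((α₃ * β₄) • d + (α₃ * β₅ + α₄ * δ) • e) (δ • e) ((α₃ * γ₄)
            • d + (α₃ * γ₅ + α₄ * ε) • e) (ε • e) ((α₃ * ζ) • e) := by
      constructor
      · intro x1 x2 x3 x4 x5 hx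
        have := F.li x1 x2 (x3 * α₃) (x3 * α₄ + x4) (x3 * α₅ + x5) (by rw [← hx]; module)
        grind
      all_goals simp only [mul_add, add_mul, mul_sub, sub_mul, smul_mul_assoc, mul_smul_comm, P] <;>
        match_scalars <;> grind
    exact G.exists_isIsomorphic_of_mul_eq hA hT

end Classification

end Tortkara

theorem mainTheorem2 :
    -- the ten algebras are nontrivial 5-dimensional nilpotent Tortkara algebras
    (∀ n : Fin 10, Module.finrank ℂ (Tortkara.T5 n) = 5 ∧
      Tortkara.IsNilpotentAlgebra (Tortkara.T5 n) ∧ Tortkara.IsTortkara (Tortkara.T5 n) ∧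
      Tortkara.IsNontrivialAlgebra (Tortkara.T5 n)) ∧
    -- every such algebra is isomorphic to exactly one of them
    (∀ (A : Type*) [NonUnitalNonAssocRing A] [Module ℂ A] [IsScalarTower ℂ A A]
      [SMulCommClass ℂ A A], Module.finrank ℂ A = 5 → Tortkara.IsNilpotentAlgebra A →
      Tortkara.IsTortkara A → Tortkara.IsNontrivialAlgebra A →
      ∃! n : Fin 10, Tortkara.IsIsomorphic A (Tortkara.T5 n)) ∧
    -- only the tenth is not a Malcev algebra
    (∀ n : Fin 10, Tortkara.IsMalcev (Tortkara.T5 n) ↔ n ≠ 9) ∧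
    -- the second cohomology spaces
    (∀ n : Fin 10, n ≠ 9 → Tortkara.ClassesFormBasis (Tortkara.T5 n)
      (Tortkara.forms n (Tortkara.pairsTM n)) (Tortkara.cohomologyTM (Tortkara.T5 n))) ∧
    (∀ n : Fin 10, Tortkara.ClassesFormBasis (Tortkara.T5 n)
      (Tortkara.forms n (Tortkara.pairsTM n ++ Tortkara.pairsExtra n))
      (Tortkara.cohomologyT (Tortkara.T5 n))) := by
  open Tortkara in
  refine ⟨fun n => ⟨finrank_T5 n, isNilpotentAlgebra_T5 n, isTortkara_T5 n,
    isNontrivialAlgebra_T5 n⟩, ?_, isMalcev_T5_iff, ?_, ?_⟩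
  · intro A _ _ _ _ hdim hnil hT hne
    obtain ⟨a, b, c, d, e, α₃, α₄, α₅, β₄, β₅, γ₄, γ₅, δ, ε, ζ, F⟩ := hnil.exists_isFrame hdim
    obtain ⟨n, hn⟩ := F.exists_isIsomorphic ⟨hT.anticomm, hdim⟩ hT.tortkara hne
    exact ⟨n, hn, fun m hm => T5_eq_of_isIsomorphic (hm.symm.trans hn)⟩
  · exact forall_fin_ten (fun _ => classesFormBasis_TM_0) (fun _ => classesFormBasis_TM_1)
      (fun _ => classesFormBasis_TM_2) (fun _ => classesFormBasis_TM_3)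
      (fun _ => classesFormBasis_TM_4) (fun _ => classesFormBasis_TM_5)
      (fun _ => classesFormBasis_TM_6) (fun _ => classesFormBasis_TM_7)
      (fun _ => classesFormBasis_TM_8) (fun h => absurd rfl h)
  · exact forall_fin_ten classesFormBasis_T_0 classesFormBasis_T_1 classesFormBasis_T_2
      classesFormBasis_T_3 classesFormBasis_T_4 classesFormBasis_T_5 classesFormBasis_T_6
      classesFormBasis_T_7 classesFormBasis_T_8 classesFormBasis_T_9
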